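/- Let $S$ be a local Artinian $\mathbf{C}$-algebra with residue field $\mathbf{C}$ and $T=\mathrm{Spec}(S)$. Let $X_0$ be a symplectic manifold, i.e. a non-singular variety over $\mathbf{C}$ of dimension $2d$ with a closed $2$-form $\omega_0\in\Gamma(X_0,\Omega^2_{X_0})$ such that $\wedge^d\omega_0$ vanishes nowhere, regarded as a Poisson scheme through $\{a,b\}=\omega_0(H_a,H_b)$, where the Hamiltonian vector field $H_a$ corresponds to $da$ under $\omega_0$. Let $X$ be a Poisson deformation of $X_0$ over $T$: a flat $T$-scheme with an $\mathcal O_T$-linear Poisson bracket on $\mathcal O_X$, together with an isomorphism of $X_0$ with the fibre of $X$ over the closed point of $T$ that respects the Poisson brackets. For a local function $a$ on $X$ put $H_a=\{a,\cdot\}$. Let $\wedge^n\Theta_{X/T}=\mathcal{H}om(\Omega^n_{X/T},\mathcal O_X)$ with the Lichnerowicz–Poisson differential $$(\delta f)(da_0\wedge\dots\wedge da_n)=\sum_{j}(-1)^j\{a_j,f(da_0\wedge\dots\widehat{da_j}\dots\wedge da_n)\}+\sum_{j<k}(-1)^{j+k}f(d\{a_j,a_k\}\wedge da_0\wedge\dots\widehat{da_j}\dots\widehat{da_k}\dots\wedge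 da_n).$$ Then there is a closed relative $2$-form $\omega\in\Gamma(X,\Omega^2_{X/T})$ with $\omega(H_a,H_b)=\{a,b\}$ for all local functions $a,b$, and there is an isomorphism of complexes of sheaves of $S$-modules on $X$ $$\phi:\ (\wedge^{\bullet}\Theta_{X/T},\delta)_{\bullet\ge 1}\ \longrightarrow\ (\Omega^{\ge 1}_{X/T},d)$$ such that $\phi(v_1\wedge\dots\wedge v_n)=\omega(v_1,\cdot)\wedge\dots\wedge\omega(v_n,\cdot)$ for local vector fields $v_k$, and $\phi(f)(H_{a_1},\dots,H_{a_n})=f(da_1\wedge\dots\wedge da_n)$ for local sections $f$ of $\wedge^n\Theta_{X/T}$ and local functions $a_k$. In particular, the Lichnerowicz–Poisson complex $\mathcal{LC}^{\bullet}(X/T)$ and the truncated relative de Rham complex are quasi-isomorphic. -/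

import Mathlib

namespace PoissonDeRham

open KaehlerDifferential

section DeRham

variable (S A : Type) [CommRing S] [CommRing A] [Algebra S A]

/-- The exterior algebra of the module of Kähler differentials. -/
abbrev FormAlg : Type := ExteriorAlgebra A Ω[A⁄S]

/-- Relative `n`-forms: `Ωⁿ_{A/S} = ⋀ⁿ_A Ω_{A/S}`. -/
abbrev Form (n : ℕ) : Type := ⋀[A]^n Ω[A⁄S]

/-- The `1`-form `da` as an element of the exterior algebra. -/
noncomputable def dd (a : A) : FormAlg S A := ExteriorAlgebra.ι A (D S A a)

/-- The grading involution. -/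
noncomputable def sgn : FormAlg S A →ₐ[A] FormAlg S A := CliffordAlgebra.involute

/-- The ring of pairs `(x, y)` with `(x, y) (x', y') = (x x', σ(x) y' + y x')`, realised by the
matrices `!![σ x, y; 0, x]`.  Ring homomorphisms into it lifting the identity are the same as
graded derivations of the exterior algebra. -/
noncomputable def twistSubring : Subring (Matrix (Fin 2) (Fin 2) (FormAlg S A)) where
  carrier := {m | m 1 0 = 0 ∧ m 0 0 = sgn S A (m 1 1)}
  mul_mem' := by
    rintro a b ⟨ha, ha'⟩ ⟨hb, hb'⟩
    simp only [Set.mem_ofPred_eq, Matrix.mul_apply, Fin.sum_univ_two]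
    simp [ha, hb, ha', hb']
  one_mem' := by simp
  add_mem' := by
    rintro a b ⟨ha, ha'⟩ ⟨hb, hb'⟩
    simp [ha, hb, ha', hb']
  zero_mem' := by simp
  neg_mem' := by
    rintro a ⟨ha, ha'⟩
    simp [ha, ha']

/-- The ring of pairs as a type. -/
abbrev Twist : Type := twistSubring S A

variable {S A}

noncomputable def Twist.mk (x y : FormAlg S A) : Twist S A :=
  ⟨!![sgn S A x, y; 0, x], by constructor <;> simp⟩

noncomputable def Twist.fst (m : Twist S A) : FormAlg S A := m.1 1 1
noncomputable def Twist.snd (m : Twist S A) : FormAlg S A := m.1 0 1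

@[simp] lemma Twist.fst_mk (x y : FormAlg S A) : (Twist.mk x y).fst = x := by
  simp [Twist.fst, Twist.mk]
@[simp] lemma Twist.snd_mk (x y : FormAlg S A) : (Twist.mk x y).snd = y := by
  simp [Twist.snd, Twist.mk]

lemma Twist.ext' {m m' : Twist S A} (h1 : m.fst = m'.fst) (h2 : m.snd = m'.snd) : m = m' := by
  obtain ⟨m, hm, hm'⟩ := m
  obtain ⟨n, hn, hn'⟩ := m'
  simp only [Twist.fst, Twist.snd] at h1 h2
  apply Subtype.ext
  ext i j
  fin_cases i <;> fin_cases j <;> simp_all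

@[simp] lemma Twist.fst_add (m m' : Twist S A) : (m + m').fst = m.fst + m'.fst := rfl
@[simp] lemma Twist.snd_add (m m' : Twist S A) : (m + m').snd = m.snd + m'.snd := rfl
@[simp] lemma Twist.fst_zero : (0 : Twist S A).fst = 0 := rfl
@[simp] lemma Twist.snd_zero : (0 : Twist S A).snd = 0 := rfl
@[simp] lemma Twist.fst_one : (1 : Twist S A).fst = 1 := by
  simp [Twist.fst]
@[simp] lemma Twist.snd_one : (1 : Twist S A).snd = 0 := by
  simp [Twist.snd]
@[simp] lemma Twist.fst_mul (m m' : Twist S A) : (m * m').fst = m.fst * m'.fst := by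
  have := m.2.1
  simp [Twist.fst, Matrix.mul_apply, Fin.sum_univ_two, this]
@[simp] lemma Twist.snd_mul (m m' : Twist S A) :
    (m * m').snd = sgn S A m.fst * m'.snd + m.snd * m'.fst := by
  have := m.2.2
  simp [Twist.fst, Twist.snd, Matrix.mul_apply, Fin.sum_univ_two, this]

lemma dd_add (a b : A) : dd S A (a + b) = dd S A a + dd S A b := by simp [dd]
lemma dd_mul (a b : A) : dd S A (a * b) = a • dd S A b + b • dd S A a := by simp [dd]

lemma sgn_dd (a : A) : sgn S A (dd S A a) = - dd S A a := by simp [sgn, dd]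

lemma dd_mul_comm (a : A) (x : FormAlg S A) : dd S A a * x = sgn S A x * dd S A a := by
  induction x using ExteriorAlgebra.induction with
  | algebraMap r => simp [Algebra.commutes]
  | ι x =>
    have := ExteriorAlgebra.ι_add_mul_swap (R := A) (D S A a) x
    simp only [dd, sgn, ExteriorAlgebra.ι, CliffordAlgebra.involute_ι] at this ⊢
    rw [eq_neg_of_add_eq_zero_left this, neg_mul]
  | mul x y hx hy => rw [← mul_assoc, hx, mul_assoc, hy, map_mul, mul_assoc]
  | add x y hx hy => rw [mul_add, hx, hy, map_add, add_mul]

variable (S A) in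
/-- `A` acts on pairs through `a ↦ (a, da)`. -/
noncomputable def twistHom : A →+* Twist S A where
  toFun a := Twist.mk (algebraMap A _ a) (dd S A a)
  map_one' := by apply Twist.ext' <;> simp [dd]
  map_zero' := by apply Twist.ext' <;> simp [dd]
  map_add' a b := by apply Twist.ext' <;> simp [dd]
  map_mul' a b := by
    apply Twist.ext'
    · simp
    · simp only [Twist.snd_mul, Twist.fst_mk, Twist.snd_mk, dd_mul, AlgHom.commutes,
        Algebra.smul_def, ← Algebra.commutes b]

@[simp] lemma fst_twistHom (a : A) : (twistHom S A a).fst = algebraMap A _ a := by simp [twistHom]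
@[simp] lemma snd_twistHom (a : A) : (twistHom S A a).snd = dd S A a := by simp [twistHom]

noncomputable instance : Algebra A (Twist S A) :=
  RingHom.toAlgebra' (twistHom S A) fun a x => by
    apply Twist.ext'
    · simp [Algebra.commutes]
    · simp only [Twist.snd_mul, fst_twistHom, snd_twistHom, AlgHom.commutes, dd_mul_comm,
        Algebra.commutes]
      rw [add_comm]

lemma twist_smul (a : A) (x : Twist S A) : a • x = twistHom S A a * x := rfl

noncomputable instance : Algebra S (Twist S A) := Algebra.compHom _ (algebraMap S A)

instance : IsScalarTower S A (Twist S A) := IsScalarTower.of_compHom S A (Twist S A)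

lemma twist_smul' (s : S) (x : Twist S A) : s • x = twistHom S A (algebraMap S A s) * x := rfl

variable (S A) in
noncomputable def twistDer : Derivation S A (Twist S A) where
  toFun b := Twist.mk (dd S A b) 0
  map_add' a b := by apply Twist.ext' <;> simp [dd]
  map_smul' s b := by
    rw [RingHom.id_apply, twist_smul']
    apply Twist.ext'
    · simp only [Twist.fst_mul, Twist.fst_mk, fst_twistHom, ← Algebra.smul_def, algebraMap_smul]
      simp [dd]
    · simp [dd]
  map_one_eq_zero' := by apply Twist.ext' <;> simp [dd]
  leibniz' a b := by
    simp only [LinearMap.coe_mk, AddHom.coe_mk, twist_smul]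
    apply Twist.ext'
    · simp [Algebra.smul_def, dd_mul]
    · simp only [Twist.snd_add, Twist.snd_mul, Twist.snd_mk, Twist.fst_mk, snd_twistHom, mul_zero,
        zero_add]
      rw [dd_mul_comm, sgn_dd]
      simp

variable (S A) in
noncomputable def twistLin : Ω[A⁄S] →ₗ[A] Twist S A := (twistDer S A).liftKaehlerDifferential

@[simp] lemma twistLin_D (b : A) : twistLin S A (D S A b) = Twist.mk (dd S A b) 0 :=
  (twistDer S A).liftKaehlerDifferential_comp_D b

lemma twistLin_swap (m n : Ω[A⁄S]) :
    twistLin S A m * twistLin S A n + twistLin S A n * twistLin S A m = 0 := by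
  have hm : m ∈ Submodule.span A (Set.range (D S A)) := by
    rw [span_range_derivation]; trivial
  have hn : n ∈ Submodule.span A (Set.range (D S A)) := by
    rw [span_range_derivation]; trivial
  induction hm using Submodule.span_induction with
  | zero => simp
  | add x y _ _ hx hy =>
    rw [map_add, add_mul, mul_add, add_add_add_comm, hx, hy, add_zero]
  | smul a x _ hx =>
    rw [map_smul, smul_mul_assoc, mul_smul_comm, ← smul_add, hx, smul_zero]
  | mem x hx =>
    obtain ⟨b, rfl⟩ := hx
    induction hn using Submodule.span_induction with
    | zero => simp
    | add x y _ _ hx hy =>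
      rw [map_add, add_mul, mul_add, add_add_add_comm, hx, hy, add_zero]
    | smul a x _ hx =>
      rw [map_smul, smul_mul_assoc, mul_smul_comm, ← smul_add, hx, smul_zero]
    | mem x hx =>
      obtain ⟨c, rfl⟩ := hx
      apply Twist.ext'
      · simp [dd]
      · simp

lemma twistLin_sq (m : Ω[A⁄S]) : twistLin S A m * twistLin S A m = 0 := by
  have hm : m ∈ Submodule.span A (Set.range (D S A)) := by
    rw [span_range_derivation]; trivial
  induction hm using Submodule.span_induction with
  | zero => simp
  | add x y _ _ hx hy =>
    have := twistLin_swap x y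
    rw [map_add, add_mul, mul_add, mul_add, hx, hy, zero_add, add_zero, this]
  | smul a x _ hx =>
    rw [map_smul, smul_mul_assoc, mul_smul_comm, hx, smul_zero, smul_zero]
  | mem x hx =>
    obtain ⟨c, rfl⟩ := hx
    apply Twist.ext'
    · simp [dd]
    · simp

variable (S A) in
noncomputable def twistLift : FormAlg S A →ₐ[A] Twist S A :=
  ExteriorAlgebra.lift A ⟨twistLin S A, twistLin_sq⟩

lemma fst_twistLin (x : Ω[A⁄S]) : (twistLin S A x).fst = ExteriorAlgebra.ι A x := by
  have hm : x ∈ Submodule.span A (Set.range (D S A)) := by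
    rw [span_range_derivation]; trivial
  induction hm using Submodule.span_induction with
  | zero => simp
  | add x y _ _ hx hy => simp [hx, hy]
  | smul a x _ hx =>
    rw [map_smul, twist_smul, Twist.fst_mul, hx, fst_twistHom, map_smul, Algebra.smul_def]
  | mem x hx =>
    obtain ⟨c, rfl⟩ := hx
    simp [dd]

lemma fst_twistLift (x : FormAlg S A) : (twistLift S A x).fst = x := by
  induction x using ExteriorAlgebra.induction with
  | algebraMap r =>
    rw [AlgHom.commutes]; exact fst_twistHom r
  | ι x => simp [twistLift, fst_twistLin]
  | mul x y hx hy => simp [hx, hy]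
  | add x y hx hy => simp [hx, hy]

variable (S A) in
/-- The exterior derivative on the whole exterior algebra `⋀_A Ω_{A/S}`: the unique additive map
with `d (a) = da`, `d (da) = 0` and `d (x y) = d x · y + σ(x) · d y`, where `σ` is the grading
involution (see the lemmas below). -/
noncomputable def extD : FormAlg S A →ₗ[S] FormAlg S A where
  toFun x := (twistLift S A x).snd
  map_add' x y := by simp
  map_smul' s x := by
    rw [← algebraMap_smul A s x, map_smul, twist_smul, Twist.snd_mul, fst_twistHom, snd_twistHom,
      AlgHom.commutes, ← Algebra.smul_def, algebraMap_smul]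
    simp [dd]

lemma extD_mul (x y : FormAlg S A) : extD S A (x * y) = extD S A x * y + sgn S A x * extD S A y := by
  simp [extD, fst_twistLift, add_comm]

lemma extD_algebraMap (a : A) : extD S A (algebraMap A _ a) = dd S A a := by
  simp only [extD, LinearMap.coe_mk, AddHom.coe_mk, AlgHom.commutes]
  exact snd_twistHom a

lemma extD_dd (a : A) : extD S A (dd S A a) = 0 := by
  simp [extD, dd, twistLift]

lemma extD_smul (a : A) (x : FormAlg S A) : extD S A (a • x) = dd S A a * x + a • extD S A x := by
  rw [Algebra.smul_def, extD_mul, extD_algebraMap, AlgHom.commutes, ← Algebra.smul_def]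

lemma extD_ιMulti {n : ℕ} (b : Fin n → A) :
    extD S A (ExteriorAlgebra.ιMulti A n fun i => D S A (b i)) = 0 := by
  induction n with
  | zero =>
    have := extD_algebraMap (S := S) (1 : A)
    simpa [dd] using this
  | succ n ih =>
    rw [ExteriorAlgebra.ιMulti_succ_apply, extD_mul]
    have h1 := extD_dd (S := S) (b 0)
    have h2 := ih (fun i => b i.succ)
    simp only [dd] at h1
    simp only [Matrix.vecTail, Function.comp_def] at *
    rw [h1, h2]; simp

/-- `n`-forms are additively generated by the forms `a db₁ ∧ … ∧ dbₙ`. -/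
lemma form_induction {n : ℕ} {p : Form S A n → Prop}
    (gen : ∀ (a : A) (b : Fin n → A), p (a • exteriorPower.ιMulti A n fun i => D S A (b i)))
    (add : ∀ x y, p x → p y → p (x + y)) (x : Form S A n) : p x := by
  have h : x ∈ Submodule.span A (Set.range fun b : Fin n → A =>
      exteriorPower.ιMulti A n fun i => D S A (b i)) := by
    have := exteriorPower.ιMulti_span_of_span A n Ω[A⁄S] (span_range_derivation S A)
    have h2 : (exteriorPower.ιMulti A n '' {a : Fin n → Ω[A⁄S] | Set.range a ⊆ Set.range (D S A)})
        = Set.range fun b : Fin n → A => exteriorPower.ιMulti A n fun i => D S A (b i) := by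
      ext y
      constructor
      · rintro ⟨v, hv, rfl⟩
        choose b hb using fun i => hv (Set.mem_range_self i)
        exact ⟨b, by simp only [hb]⟩
      · rintro ⟨b, rfl⟩
        refine ⟨fun i => D S A (b i), ?_, rfl⟩
        rintro _ ⟨i, rfl⟩
        exact ⟨b i, rfl⟩
    rw [← h2, this]
    trivial
  have h0 : p 0 := by simpa using gen 0 (fun _ => 0)
  have key : ∀ a : A, p (a • x) := by
    induction h using Submodule.span_induction with
    | zero => simpa using h0
    | mem x hx =>
      obtain ⟨b, rfl⟩ := hx
      exact fun a => gen a b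
    | add x y _ _ hx hy =>
      intro a
      rw [smul_add]
      exact add _ _ (hx a) (hy a)
    | smul c x _ hx =>
      intro a
      rw [smul_smul]
      exact hx _
  simpa using key 1

/-- Two additive maps on forms agree if they agree on the forms `a db₁ ∧ … ∧ dbₙ`. -/
lemma form_hom_ext {n : ℕ} {M : Type*} [AddCommMonoid M] {f g : Form S A n →+ M}
    (h : ∀ (a : A) (b : Fin n → A), f (a • exteriorPower.ιMulti A n fun i => D S A (b i)) =
      g (a • exteriorPower.ιMulti A n fun i => D S A (b i))) : f = g := by
  ext x
  induction x using form_induction with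
  | gen a b => exact h a b
  | add x y hx hy => rw [map_add, map_add, hx, hy]

lemma extD_gen {n : ℕ} (a : A) (b : Fin n → A) :
    extD S A (a • ExteriorAlgebra.ιMulti A n fun i => D S A (b i)) =
      ExteriorAlgebra.ιMulti A (n + 1) fun i => D S A ((Fin.cons a b : Fin (n + 1) → A) i) := by
  rw [extD_smul, extD_ιMulti, smul_zero, add_zero, ExteriorAlgebra.ιMulti_succ_apply]
  rfl

lemma extD_mem {n : ℕ} (x : Form S A n) : extD S A (x : FormAlg S A) ∈ ⋀[A]^(n + 1) Ω[A⁄S] := by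
  induction x using form_induction with
  | gen a b =>
    have := extD_gen (S := S) a b
    simp only [Submodule.coe_smul, exteriorPower.ιMulti_apply_coe, this]
    exact ExteriorAlgebra.ιMulti_range A (n + 1) (Set.mem_range_self _)
  | add x y hx hy =>
    rw [Submodule.coe_add, map_add]
    exact add_mem hx hy

variable (S A) in
/-- The exterior derivative `d : Ωⁿ_{A/S} → Ωⁿ⁺¹_{A/S}`. -/
noncomputable def formD (n : ℕ) : Form S A n →ₗ[S] Form S A (n + 1) where
  toFun x := ⟨extD S A x, extD_mem x⟩
  map_add' x y := by ext; simp
  map_smul' s x := by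
    ext
    exact (extD S A).map_smul s x

/-- `d (a db₁ ∧ … ∧ dbₙ) = da ∧ db₁ ∧ … ∧ dbₙ`. -/
lemma formD_gen {n : ℕ} (a : A) (b : Fin n → A) :
    formD S A n (a • exteriorPower.ιMulti A n fun i => D S A (b i)) =
      exteriorPower.ιMulti A (n + 1) fun i => D S A ((Fin.cons a b : Fin (n + 1) → A) i) := by
  ext
  exact extD_gen a b

lemma formD_formD {n : ℕ} (x : Form S A n) : formD S A (n + 1) (formD S A n x) = 0 := by
  induction x using form_induction with
  | gen a b =>
    rw [formD_gen]
    ext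
    exact extD_ιMulti _
  | add x y hx hy => rw [map_add, map_add, hx, hy, add_zero]

end DeRham

section Poisson

/-- A Poisson bracket on the commutative `S`-algebra `A`. -/
structure PoissonBracket (S A : Type) [CommRing S] [CommRing A] [Algebra S A] where
  br : A →ₗ[S] A →ₗ[S] A
  self (a : A) : br a a = 0
  jacobi (a b c : A) : br a (br b c) + br b (br c a) + br c (br a b) = 0
  leibniz (a b c : A) : br a (b * c) = br a b * c + br a c * b

variable {S A : Type} [CommRing S] [CommRing A] [Algebra S A] (P : PoissonBracket S A)

namespace PoissonBracket

lemma swap (a b : A) : P.br a b = - P.br b a := by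
  have h := P.self (a + b)
  simp only [map_add, LinearMap.add_apply, P.self, zero_add, add_zero] at h
  linear_combination h

lemma jacobi' (a b c : A) : P.br (P.br a b) c = P.br a (P.br b c) - P.br b (P.br a c) := by
  have h := P.jacobi a b c
  rw [P.swap c (P.br a b), P.swap c a, map_neg] at h
  linear_combination -h

lemma leibniz' (a b c : A) : P.br (a * b) c = a * P.br b c + b * P.br a c := by
  rw [P.swap, P.leibniz, P.swap c a, P.swap c b]; ring

/-- The Hamiltonian vector field `H_a = {a, ·}`. -/
def ham (a : A) : Derivation S A A where
  toLinearMap := P.br a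
  map_one_eq_zero' := by
    have := P.leibniz a 1 1
    simp only [mul_one] at this
    simpa using this
  leibniz' b c := by
    simp only [P.leibniz, smul_eq_mul]
    ring

/-- The Lie derivative of an alternating cochain along `H_a`. -/
def lieFun {n : ℕ} (a : A) (f : A [⋀^Fin n]→ₗ[S] A) (v : Fin n → A) : A :=
  P.br a (f v) - ∑ i, f (Function.update v i (P.br a (v i)))

/-- The formula of the Lichnerowicz–Poisson differential on an alternating map `f` in `n`
variables:
`(δ f)(a₀, …, aₙ) = ∑_j (-1)^j {a_j, f(…, â_j, …)} + ∑_{j<k} (-1)^{j+k} f({a_j, a_k}, …, â_j, …, â_k, …)`.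
In the second sum the entry `{a_j, a_k}` is moved from the first position to the position of the
omitted `a_j`, which accounts for a sign `(-1)^j`. -/
def lpFun {n : ℕ} (f : A [⋀^Fin n]→ₗ[S] A) (v : Fin (n + 1) → A) : A :=
  ∑ j : Fin (n + 1), (-1) ^ (j : ℕ) * P.br (v j) (f (j.removeNth v)) +
    ∑ j : Fin (n + 1), ∑ k : Fin (n + 1), if j < k then
      (-1) ^ (k : ℕ) * f (k.removeNth (Function.update v j (P.br (v j) (v k)))) else 0

variable {n : ℕ}

lemma lpFun_zero (f : A [⋀^Fin 0]→ₗ[S] A) (v : Fin 1 → A) :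
    P.lpFun f v = P.br (v 0) (f ![]) := by
  simp [lpFun]
  congr! 2

lemma lieFun_cons (a c : A) (f : A [⋀^Fin (n + 1)]→ₗ[S] A) (w : Fin n → A) :
    P.lieFun a f (Fin.cons c w) = P.lieFun a (f.curryLeft c) w - f.curryLeft (P.br a c) w := by
  simp only [lieFun, Fin.sum_univ_succ, Fin.cons_zero, Fin.cons_succ, Fin.update_cons_zero,
    ← Fin.cons_update, AlternatingMap.curryLeft_apply_apply, Matrix.vecCons]
  ring

lemma removeNth_succ_cons' {T : Type} (a : T) (w : Fin (n + 1) → T) (j : Fin (n + 1)) :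
    j.succ.removeNth (Fin.cons a w : Fin (n + 2) → T) = Fin.cons a (j.removeNth w) := by
  funext i
  refine Fin.cases ?_ (fun i => ?_) i <;> simp [Fin.removeNth, Fin.succ_succAbove_succ]

lemma map_cons_removeNth (f : A [⋀^Fin (n + 1)]→ₗ[S] A) (k : Fin (n + 1)) (x : A)
    (w : Fin (n + 1) → A) :
    (-1) ^ (k : ℕ) * f (Fin.cons x (k.removeNth w)) = f (Function.update w k x) := by
  have := f.map_insertNth k x (k.removeNth w)
  rw [Fin.insertNth_removeNth] at this
  rw [this]
  simp [Matrix.vecCons]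

lemma lpFun_cons (a : A) (f : A [⋀^Fin (n + 1)]→ₗ[S] A) (w : Fin (n + 1) → A) :
    P.lpFun f (Fin.cons a w) = P.lieFun a f w - P.lpFun (f.curryLeft a) w := by
  simp only [lpFun, lieFun, Fin.sum_univ_succ (n := n + 1), Fin.cons_zero, Fin.cons_succ,
    Fin.update_cons_zero, removeNth_succ_cons', ← Fin.cons_update, Fin.succ_pos, if_true,
    Fin.succ_lt_succ_iff, if_false, Fin.not_lt_zero, Fin.val_succ, Fin.val_zero,
    pow_zero, one_mul, Fin.removeNth_zero, Fin.tail_cons, zero_add,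
    AlternatingMap.curryLeft_apply_apply, Matrix.vecCons, pow_succ, mul_neg_one, neg_mul,
    Finset.sum_neg_distrib]
  have : ∀ (j k : Fin (n + 1)), (if j < k then
      -((-1) ^ (k : ℕ) * f (Fin.cons a (k.removeNth (Function.update w j (P.br (w j) (w k))))))
      else 0) = - (if j < k then
      ((-1) ^ (k : ℕ) * f (Fin.cons a (k.removeNth (Function.update w j (P.br (w j) (w k))))))
      else 0) := by
    intro j k; split_ifs <;> simp
  simp only [this, Finset.sum_neg_distrib]
  simp only [map_cons_removeNth]
  ring

lemma lieFun_add (a : A) (f g : A [⋀^Fin n]→ₗ[S] A) (v : Fin n → A) :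
    P.lieFun a (f + g) v = P.lieFun a f v + P.lieFun a g v := by
  simp only [lieFun, AlternatingMap.add_apply, map_add, Finset.sum_add_distrib]
  ring

lemma lieFun_smul (s : S) (a : A) (f : A [⋀^Fin n]→ₗ[S] A) (v : Fin n → A) :
    P.lieFun a (s • f) v = s • P.lieFun a f v := by
  simp only [lieFun, AlternatingMap.smul_apply, map_smul, smul_sub, Finset.smul_sum]

lemma lieFun_add_left (a b : A) (f : A [⋀^Fin n]→ₗ[S] A) (v : Fin n → A) :
    P.lieFun (a + b) f v = P.lieFun a f v + P.lieFun b f v := by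
  simp only [lieFun, LinearMap.add_apply, map_add, f.map_update_add, Finset.sum_add_distrib]
  ring

lemma lieFun_smul_left (s : S) (a : A) (f : A [⋀^Fin n]→ₗ[S] A) (v : Fin n → A) :
    P.lieFun (s • a) f v = s • P.lieFun a f v := by
  simp only [lieFun, LinearMap.smul_apply, map_smul, f.map_update_smul, smul_sub, Finset.smul_sum]

lemma lpFun_add (f g : A [⋀^Fin n]→ₗ[S] A) (v : Fin (n + 1) → A) :
    P.lpFun (f + g) v = P.lpFun f v + P.lpFun g v := by
  simp only [lpFun, AlternatingMap.add_apply, map_add, mul_add, ite_add_zero,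
    Finset.sum_add_distrib]
  ring

lemma lpFun_smul (s : S) (f : A [⋀^Fin n]→ₗ[S] A) (v : Fin (n + 1) → A) :
    P.lpFun (s • f) v = s • P.lpFun f v := by
  simp only [lpFun, AlternatingMap.smul_apply, map_smul, smul_add, Finset.smul_sum, smul_ite,
    smul_zero, mul_smul_comm]

lemma lpFun_sub (f g : A [⋀^Fin n]→ₗ[S] A) (v : Fin (n + 1) → A) :
    P.lpFun (f - g) v = P.lpFun f v - P.lpFun g v := by
  rw [eq_sub_iff_add_eq, ← lpFun_add, sub_add_cancel]

/-- The Lie derivative as an alternating map. -/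
def lie (a : A) (f : A [⋀^Fin n]→ₗ[S] A) : A [⋀^Fin n]→ₗ[S] A where
  toFun := P.lieFun a f
  map_update_add' := by
    intro inst v i x y
    obtain rfl := Subsingleton.elim inst (instDecidableEqFin n)
    induction n with
    | zero => exact i.elim0
    | succ n ih =>
      refine Fin.consCases (fun c w => ?_) v
      refine Fin.cases ?_ (fun i => ?_) i
      · simp only [Fin.update_cons_zero, lieFun_cons, map_add, lieFun_add,
          AlternatingMap.add_apply]
        ring
      · simp only [← Fin.cons_update, lieFun_cons, ih, AlternatingMap.map_update_add]
        ring
  map_update_smul' := by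
    intro inst v i c x
    obtain rfl := Subsingleton.elim inst (instDecidableEqFin n)
    induction n with
    | zero => exact i.elim0
    | succ n ih =>
      refine Fin.consCases (fun c w => ?_) v
      refine Fin.cases ?_ (fun i => ?_) i
      · simp only [Fin.update_cons_zero, lieFun_cons, map_smul, lieFun_smul,
          AlternatingMap.smul_apply, smul_sub]
      · simp only [← Fin.cons_update, lieFun_cons, ih, AlternatingMap.map_update_smul, smul_sub]
  map_eq_zero_of_eq' := by
    intro v i j hij hne
    simp only [lieFun, f.map_eq_zero_of_eq v hij hne, map_zero, zero_sub, neg_eq_zero]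
    rw [Finset.sum_eq_add i j hne]
    · have := f.map_swap (Function.update v i (P.br a (v i))) hne
      have h2 : (Function.update v i (P.br a (v i))) ∘ Equiv.swap i j =
          Function.update v j (P.br a (v j)) := by
        funext k
        rcases eq_or_ne k i with rfl | hi
        · simp [hne, hne.symm, hij]
        · rcases eq_or_ne k j with rfl | hj
          · simp [hij]
          · simp [Equiv.swap_apply_of_ne_of_ne hi hj, hi, hj]
      rw [h2] at this
      rw [this, add_neg_cancel]
    · intro k _ hk
      apply f.map_eq_zero_of_eq _ _ hne
      simp [hk.1.symm, hk.2.symm, hij]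
    · simp
    · simp

@[simp] lemma lie_apply (a : A) (f : A [⋀^Fin n]→ₗ[S] A) (v : Fin n → A) :
    P.lie a f v = P.lieFun a f v := rfl

lemma exists_lpAlt : ∀ {n : ℕ} (f : A [⋀^Fin n]→ₗ[S] A),
    ∃ g : A [⋀^Fin (n + 1)]→ₗ[S] A, ∀ v, g v = P.lpFun f v := by
  intro n
  induction n with
  | zero =>
    intro f
    refine ⟨⟨⟨fun v => P.lpFun f v, ?_, ?_⟩, ?_⟩, fun v => rfl⟩
    · intro inst v i x y
      obtain rfl := Subsingleton.elim (α := Fin 1) i 0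
      simp [lpFun_zero]
    · intro inst v i x y
      obtain rfl := Subsingleton.elim (α := Fin 1) i 0
      simp [lpFun_zero]
    · intro v i j _ h
      exact absurd (Subsingleton.elim (α := Fin 1) i j) h
  | succ n ih =>
    intro f
    choose g hg using ih
    have hT : ∀ a w, P.lpFun f (Fin.cons a w) = (P.lie a f - g (f.curryLeft a)) w := by
      intro a w
      rw [lpFun_cons, AlternatingMap.sub_apply, hg, lie_apply]
    have h0 : ∀ (a : A) (u : Fin n → A), P.lpFun f (Fin.cons a (Fin.cons a u)) = 0 := by
      intro a u
      rw [lpFun_cons, lieFun_cons, P.self, map_zero, AlternatingMap.zero_apply, sub_zero]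
      cases n with
      | zero =>
        rw [lpFun_zero]
        simp only [lieFun, Finset.univ_eq_empty, Finset.sum_empty, sub_zero, Fin.cons_zero]
        rw [sub_eq_zero]
        congr 2
        exact Subsingleton.elim _ _
      | succ m =>
        rw [lpFun_cons, AlternatingMap.curryLeft_same]
        simp [lpFun]
    refine ⟨⟨⟨fun v => P.lpFun f v, ?_, ?_⟩, ?_⟩, fun v => rfl⟩
    · intro inst v i x y
      obtain rfl := Subsingleton.elim inst (instDecidableEqFin _)
      refine Fin.consCases (fun c w => ?_) v
      refine Fin.cases ?_ (fun i => ?_) i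
      · simp only [Fin.update_cons_zero, lpFun_cons, map_add, lieFun_add_left, lpFun_add]
        ring
      · simp only [← Fin.cons_update, hT, AlternatingMap.map_update_add]
    · intro inst v i c x
      obtain rfl := Subsingleton.elim inst (instDecidableEqFin _)
      refine Fin.consCases (fun c w => ?_) v
      refine Fin.cases ?_ (fun i => ?_) i
      · simp only [Fin.update_cons_zero, lpFun_cons, map_smul, lieFun_smul_left, lpFun_smul,
          smul_sub]
      · simp only [← Fin.cons_update, hT, AlternatingMap.map_update_smul]
    · have key : ∀ (a : A) (w : Fin (n + 1) → A) (j : Fin (n + 1)), w j = a →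
          P.lpFun f (Fin.cons a w) = 0 := by
        intro a w j hj
        rcases eq_or_ne j 0 with rfl | hj0
        · rw [← Fin.cons_self_tail w, hj]
          exact h0 a _
        · have h := (P.lie a f - g (f.curryLeft a)).map_swap w hj0
          have h1 : (w ∘ Equiv.swap j 0) 0 = a := by simp [hj]
          rw [← hT, ← hT, ← Fin.cons_self_tail (w ∘ Equiv.swap j 0), h1, h0] at h
          rw [← neg_eq_zero, ← h]
      intro v i j hij hne
      induction v using Fin.consCases with
      | _ c w =>
      induction i using Fin.cases with
      | zero =>
        induction j using Fin.cases with
        | zero => exact absurd rfl hne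
        | succ j => exact key c w j hij.symm
      | succ i =>
        induction j using Fin.cases with
        | zero => exact key c w i hij
        | succ j =>
          change P.lpFun f (Fin.cons c w) = 0
          rw [hT]
          exact AlternatingMap.map_eq_zero_of_eq _ w hij (fun h => hne (congrArg _ h))

/-- The Lichnerowicz–Poisson differential on alternating maps. -/
noncomputable def lpAlt (f : A [⋀^Fin n]→ₗ[S] A) : A [⋀^Fin (n + 1)]→ₗ[S] A where
  toFun := P.lpFun f
  map_update_add' v i x y := by
    obtain ⟨g, hg⟩ := P.exists_lpAlt f
    simp only [← hg, AlternatingMap.map_update_add]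
  map_update_smul' v i x y := by
    obtain ⟨g, hg⟩ := P.exists_lpAlt f
    simp only [← hg, AlternatingMap.map_update_smul]
  map_eq_zero_of_eq' v i j hij hne := by
    obtain ⟨g, hg⟩ := P.exists_lpAlt f
    simp only [← hg]
    exact g.map_eq_zero_of_eq v hij hne

@[simp] lemma lpAlt_apply (f : A [⋀^Fin n]→ₗ[S] A) (v : Fin (n + 1) → A) :
    P.lpAlt f v = P.lpFun f v := rfl

lemma lpAlt_add (f g : A [⋀^Fin n]→ₗ[S] A) : P.lpAlt (f + g) = P.lpAlt f + P.lpAlt g := by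
  ext v; exact P.lpFun_add f g v

lemma lpAlt_sub (f g : A [⋀^Fin n]→ₗ[S] A) : P.lpAlt (f - g) = P.lpAlt f - P.lpAlt g := by
  ext v; exact P.lpFun_sub f g v

lemma lpAlt_smul (s : S) (f : A [⋀^Fin n]→ₗ[S] A) : P.lpAlt (s • f) = s • P.lpAlt f := by
  ext v; exact P.lpFun_smul s f v

lemma lie_sub (a : A) (f g : A [⋀^Fin n]→ₗ[S] A) : P.lie a (f - g) = P.lie a f - P.lie a g := by
  rw [eq_sub_iff_add_eq]
  ext v
  rw [AlternatingMap.add_apply, lie_apply, lie_apply, ← lieFun_add, sub_add_cancel]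
  rfl

lemma curry_ext {f g : A [⋀^Fin (n + 1)]→ₗ[S] A} (h : ∀ a, f.curryLeft a = g.curryLeft a) :
    f = g := by
  ext v
  rw [← Fin.cons_self_tail v]
  exact congrArg (fun F => F (Fin.tail v)) (h (v 0))

lemma curry_lie (a c : A) (f : A [⋀^Fin (n + 1)]→ₗ[S] A) :
    (P.lie a f).curryLeft c = P.lie a (f.curryLeft c) - f.curryLeft (P.br a c) := by
  ext v
  exact P.lieFun_cons a c f v

lemma curry_lpAlt (a : A) (f : A [⋀^Fin (n + 1)]→ₗ[S] A) :
    (P.lpAlt f).curryLeft a = P.lie a f - P.lpAlt (f.curryLeft a) := by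
  ext v
  exact P.lpFun_cons a f v

lemma curry_lpAlt_zero (a : A) (f : A [⋀^Fin 0]→ₗ[S] A) :
    (P.lpAlt f).curryLeft a = P.lie a f := by
  ext v
  have := P.lpFun_zero f (Fin.cons a v)
  rw [AlternatingMap.curryLeft_apply_apply, lpAlt_apply]
  refine this.trans ?_
  simp [lieFun]
  congr! 2

lemma lie_lie (a b : A) (f : A [⋀^Fin n]→ₗ[S] A) :
    P.lie a (P.lie b f) - P.lie b (P.lie a f) = P.lie (P.br a b) f := by
  induction n generalizing a b with
  | zero =>
    ext v
    simp [lieFun, P.jacobi']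
  | succ n ih =>
    refine curry_ext fun c => ?_
    have h := ih a b (f.curryLeft c)
    rw [← AlternatingMap.curryLeftLinearMap_apply, map_sub]
    simp only [AlternatingMap.curryLeftLinearMap_apply, LinearMap.sub_apply, curry_lie, lie_sub]
    rw [P.jacobi' a b c, map_sub, ← h]
    abel

lemma lie_lpAlt (a : A) (f : A [⋀^Fin n]→ₗ[S] A) :
    P.lie a (P.lpAlt f) = P.lpAlt (P.lie a f) := by
  induction n generalizing a with
  | zero =>
    refine curry_ext fun c => ?_
    rw [curry_lie, curry_lpAlt_zero, curry_lpAlt_zero, curry_lpAlt_zero, ← lie_lie]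
    abel
  | succ n ih =>
    refine curry_ext fun c => ?_
    rw [curry_lie, curry_lpAlt, curry_lpAlt, curry_lpAlt, curry_lie, lie_sub, ih, lpAlt_sub,
      ← lie_lie]
    abel

lemma lpAlt_lpAlt (f : A [⋀^Fin n]→ₗ[S] A) : P.lpAlt (P.lpAlt f) = 0 := by
  induction n with
  | zero =>
    refine curry_ext fun c => ?_
    rw [curry_lpAlt, curry_lpAlt_zero, lie_lpAlt]
    simp
  | succ n ih =>
    refine curry_ext fun c => ?_
    rw [curry_lpAlt, curry_lpAlt, lpAlt_sub, lie_lpAlt, ih]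
    simp

end PoissonBracket

/-- An alternating map which is a derivation in each variable. -/
def IsMultiDer {n : ℕ} (f : A [⋀^Fin n]→ₗ[S] A) : Prop :=
  ∀ (v : Fin n → A) (i : Fin n) (x y : A), f (Function.update v i (x * y)) =
    x * f (Function.update v i y) + y * f (Function.update v i x)

lemma isMultiDer_of_zero {n : ℕ} {f : A [⋀^Fin (n + 1)]→ₗ[S] A}
    (h : ∀ (w : Fin n → A) (x y : A), f (Fin.cons (x * y) w) =
      x * f (Fin.cons y w) + y * f (Fin.cons x w)) : IsMultiDer f := by
  intro v i x y
  simp only [← PoissonBracket.map_cons_removeNth, h]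
  ring

lemma IsMultiDer.cons {n : ℕ} {f : A [⋀^Fin (n + 1)]→ₗ[S] A} (h : IsMultiDer f)
    (w : Fin n → A) (x y : A) : f (Fin.cons (x * y) w) =
      x * f (Fin.cons y w) + y * f (Fin.cons x w) := by
  simpa using h (Fin.cons 0 w) 0 x y

namespace PoissonBracket

lemma lpFun_mul {n : ℕ} (x : A) (f g : A [⋀^Fin n]→ₗ[S] A) (h : ∀ v, g v = x * f v)
    (w : Fin (n + 1) → A) :
    P.lpFun g w = x * P.lpFun f w +
      ∑ j : Fin (n + 1), (-1) ^ (j : ℕ) * (P.br (w j) x * f (j.removeNth w)) := by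
  have h1 : ∀ j : Fin (n + 1), (-1) ^ (j : ℕ) * P.br (w j) (g (j.removeNth w)) =
      x * ((-1) ^ (j : ℕ) * P.br (w j) (f (j.removeNth w))) +
        (-1) ^ (j : ℕ) * (P.br (w j) x * f (j.removeNth w)) := by
    intro j
    rw [h, P.leibniz]; ring
  have h2 : ∀ j k : Fin (n + 1), (if j < k then (-1) ^ (k : ℕ) *
      g (k.removeNth (Function.update w j (P.br (w j) (w k)))) else 0) =
      x * (if j < k then (-1) ^ (k : ℕ) *
      f (k.removeNth (Function.update w j (P.br (w j) (w k)))) else 0) := by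
    intro j k
    split_ifs
    · rw [h]; ring
    · simp
  simp only [lpFun, h1, h2, Finset.sum_add_distrib, mul_add, Finset.mul_sum]
  ring

lemma isMultiDer_lpAlt {n : ℕ} (f : A [⋀^Fin n]→ₗ[S] A) (h : IsMultiDer f) :
    IsMultiDer (P.lpAlt f) := by
  refine isMultiDer_of_zero fun w x y => ?_
  cases n with
  | zero => simp [lpFun_zero, P.leibniz']
  | succ n =>
    simp only [lpAlt_apply, lpFun_cons]
    have e1 := P.lpFun_mul x (f.curryLeft y) (x • f.curryLeft y) (fun v => rfl) w
    have e2 := P.lpFun_mul y (f.curryLeft x) (y • f.curryLeft x) (fun v => rfl) w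
    have e : f.curryLeft (x * y) = x • f.curryLeft y + y • f.curryLeft x := by
      ext v
      exact h.cons v x y
    have e3 : ∀ j : Fin (n + 1), (-1) ^ (j : ℕ) * (P.br (w j) x * f.curryLeft y (j.removeNth w))
        = - (P.br x (w j) * f (Function.update w j y)) := by
      intro j
      rw [← map_cons_removeNth, P.swap (w j) x]
      simp only [AlternatingMap.curryLeft_apply_apply, Matrix.vecCons]
      ring
    have e4 : ∀ j : Fin (n + 1), (-1) ^ (j : ℕ) * (P.br (w j) y * f.curryLeft x (j.removeNth w))
        = - (P.br y (w j) * f (Function.update w j x)) := by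
      intro j
      rw [← map_cons_removeNth, P.swap (w j) y]
      simp only [AlternatingMap.curryLeft_apply_apply, Matrix.vecCons]
      ring
    have e5 : ∀ j : Fin (n + 1), f (Function.update w j (P.br (x * y) (w j))) =
        x * f (Function.update w j (P.br y (w j))) + y * f (Function.update w j (P.br x (w j))) +
        P.br y (w j) * f (Function.update w j x) + P.br x (w j) * f (Function.update w j y) := by
      intro j
      rw [P.leibniz', f.map_update_add, h, h]
      ring
    simp only [e3, e4, Finset.sum_neg_distrib] at e1 e2
    rw [e, lpFun_add, e1, e2]
    simp only [lieFun, e5, Finset.sum_add_distrib, ← Finset.mul_sum]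
    simp only [P.leibniz']
    ring

end PoissonBracket
end Poisson

section Polyvector

open KaehlerDifferential

variable (S A : Type) [CommRing S] [CommRing A] [Algebra S A]

/-- Relative polyvector fields of degree `n`: `⋀ⁿ Θ_{A/S} = Hom_A(Ωⁿ_{A/S}, A)`. -/
abbrev Polyvector (n : ℕ) : Type := Form S A n →ₗ[A] A

variable {S A}

/-- The alternating multiderivation `(a₁, …, aₙ) ↦ f(da₁ ∧ … ∧ daₙ)` of a polyvector field. -/
noncomputable def Polyvector.toAlt {n : ℕ} (f : Polyvector S A n) : A [⋀^Fin n]→ₗ[S] A :=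
  { toFun := fun v => f (exteriorPower.ιMulti A n fun i => D S A (v i))
    map_update_add' := by
      intro inst v i x y
      have : ∀ z, (fun j => D S A (Function.update v i z j)) =
          Function.update (fun j => D S A (v j)) i (D S A z) :=
        fun z => funext fun j => Function.apply_update (fun _ => D S A) v i z j
      simp only [this, map_add, AlternatingMap.map_update_add]
    map_update_smul' := by
      intro inst v i c x
      have : ∀ z, (fun j => D S A (Function.update v i z j)) =
          Function.update (fun j => D S A (v j)) i (D S A z) :=
        fun z => funext fun j => Function.apply_update (fun _ => D S A) v i z j
      simp only [this, Derivation.map_smul]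
      rw [← algebraMap_smul A c (D S A x), AlternatingMap.map_update_smul, map_smul,
        algebraMap_smul]
    map_eq_zero_of_eq' := by
      intro v i j hij hne
      rw [AlternatingMap.map_eq_zero_of_eq _ _ (by rw [hij]) hne, map_zero] }

@[simp] lemma Polyvector.toAlt_apply {n : ℕ} (f : Polyvector S A n) (v : Fin n → A) :
    f.toAlt v = f (exteriorPower.ιMulti A n fun i => D S A (v i)) := rfl

lemma Polyvector.isMultiDer_toAlt {n : ℕ} (f : Polyvector S A n) : IsMultiDer f.toAlt := by
  intro v i x y
  simp only [Polyvector.toAlt_apply]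
  have : ∀ z, (fun j => D S A (Function.update v i z j)) =
      Function.update (fun j => D S A (v j)) i (D S A z) := by
    intro z
    funext j
    exact Function.apply_update (fun _ => D S A) v i z j
  simp only [this, Derivation.leibniz, AlternatingMap.map_update_add,
    AlternatingMap.map_update_smul, map_add, map_smul, smul_eq_mul]

lemma Polyvector.ext' {n : ℕ} {f g : Polyvector S A n} (h : ∀ v, f.toAlt v = g.toAlt v) :
    f = g := by
  apply LinearMap.toAddMonoidHom_injective
  apply form_hom_ext
  intro a b
  have := h b
  simp only [Polyvector.toAlt_apply] at this
  simp [this]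

lemma alt_ext {n : ℕ} {f g : Ω[A⁄S] [⋀^Fin n]→ₗ[A] A}
    (h : ∀ v : Fin n → A, f (fun i => D S A (v i)) = g (fun i => D S A (v i))) : f = g := by
  apply exteriorPower.alternatingMapLinearEquiv.injective
  apply Polyvector.ext'
  intro v
  simpa using h v

lemma exists_lift : ∀ {n : ℕ} (f : A [⋀^Fin n]→ₗ[S] A), IsMultiDer f →
    ∃ g : Ω[A⁄S] [⋀^Fin n]→ₗ[A] A, ∀ v : Fin n → A, g (fun i => D S A (v i)) = f v := by
  intro n
  induction n with
  | zero =>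
    intro f _
    refine ⟨AlternatingMap.constOfIsEmpty A _ _ (f ![]), fun v => ?_⟩
    rw [Subsingleton.elim v ![]]
    rfl
  | succ n ih =>
    intro f hf
    have hf' : ∀ a, IsMultiDer (f.curryLeft a) := by
      intro a v i x y
      have := hf (Fin.cons a v) i.succ x y
      simp only [← Fin.cons_update] at this
      exact this
    choose G hG using fun a => ih (f.curryLeft a) (hf' a)
    have : IsScalarTower S A (Ω[A⁄S] [⋀^Fin n]→ₗ[A] A) :=
      ⟨fun s a F => AlternatingMap.ext fun v => smul_assoc s a (F v)⟩
    let Dr : Derivation S A (Ω[A⁄S] [⋀^Fin n]→ₗ[A] A) :=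
      { toFun := G
        map_add' := fun a b => alt_ext fun v => by simp [hG]
        map_smul' := fun s a => alt_ext fun v => by
          rw [RingHom.id_apply, AlternatingMap.smul_apply, hG, hG, map_smul]; rfl
        map_one_eq_zero' := alt_ext fun v => by
          have := hf.cons v 1 1
          simp only [mul_one, one_mul, left_eq_add] at this
          simpa [hG, Matrix.vecCons] using this
        leibniz' := fun a b => alt_ext fun v => by
          have := hf.cons v a b
          simpa [hG, Matrix.vecCons] using this }
    let T := Dr.liftKaehlerDifferential
    have hT : ∀ a, T (D S A a) = G a := fun a => Dr.liftKaehlerDifferential_comp_D a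
    have hz : ∀ (x : Ω[A⁄S]) (w : Fin n → Ω[A⁄S]) (j : Fin n), w j = x → T x w = 0 := by
      cases n with
      | zero => intro x w j; exact j.elim0
      | succ n =>
        have mem : ∀ m : Ω[A⁄S], m ∈ Submodule.span A (Set.range (D S A)) := by
          intro m; rw [span_range_derivation]; trivial
        have sw : ∀ x y, (T x).curryLeft y + (T y).curryLeft x = 0 := by
          intro x y
          induction mem x using Submodule.span_induction with
          | zero => simp
          | add x x' _ _ hx hx' =>
            rw [map_add, map_add, AlternatingMap.curryLeft_add, LinearMap.add_apply,
              add_add_add_comm, hx, hx', add_zero]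
          | smul a x _ hx =>
            rw [map_smul, map_smul, AlternatingMap.curryLeft_smul, LinearMap.smul_apply,
              ← smul_add, hx, smul_zero]
          | mem x hx =>
            obtain ⟨b, rfl⟩ := hx
            induction mem y using Submodule.span_induction with
            | zero => simp
            | add x x' _ _ hx hx' =>
              rw [map_add, map_add, AlternatingMap.curryLeft_add, LinearMap.add_apply,
                add_add_add_comm, hx, hx', add_zero]
            | smul a x _ hx =>
              rw [map_smul, map_smul, AlternatingMap.curryLeft_smul, LinearMap.smul_apply,
                ← smul_add, hx, smul_zero]
            | mem x hx =>
              obtain ⟨c, rfl⟩ := hx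
              apply alt_ext
              intro v
              have h1 := hG b (Fin.cons c v)
              have h2 := hG c (Fin.cons b v)
              have e : ∀ c : A, (fun i => D S A ((Fin.cons c v : Fin (n + 1) → A) i)) =
                  Matrix.vecCons (D S A c) fun i => D S A (v i) := by
                intro c
                funext i
                refine Fin.cases ?_ (fun i => ?_) i <;> rfl
              rw [e] at h1 h2
              simp only [AlternatingMap.add_apply, AlternatingMap.curryLeft_apply_apply, hT, h1, h2,
                AlternatingMap.zero_apply]
              have h3 := f.map_swap (Fin.cons b (Fin.cons c v)) (i := 0) (j := 1) (by simp)
              have h4 : (Fin.cons b (Fin.cons c v) : Fin (n + 2) → A) ∘ Equiv.swap 0 1 =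
                  Fin.cons c (Fin.cons b v) := by
                funext i
                refine Fin.cases ?_ (fun i => Fin.cases ?_ (fun i => ?_) i) i
                · simp
                · simp
                · have h5 : Equiv.swap (0 : Fin (n + 2)) 1 i.succ.succ = i.succ.succ :=
                    Equiv.swap_apply_of_ne_of_ne (Fin.succ_ne_zero _)
                      (fun h => Fin.succ_ne_zero i (Fin.succ_injective _ h))
                  simp [h5]
              rw [h4] at h3
              simp only [Matrix.vecCons, h3, add_neg_cancel]
        have same : ∀ x, (T x).curryLeft x = 0 := by
          intro x
          induction mem x using Submodule.span_induction with
          | zero => simp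
          | add x x' _ _ hx hx' =>
            have := sw x x'
            simp only [map_add, AlternatingMap.curryLeft_add, LinearMap.add_apply, hx, hx',
              zero_add, add_zero]
            rw [add_comm, this]
          | smul a x _ hx =>
            rw [map_smul, map_smul, AlternatingMap.curryLeft_smul, LinearMap.smul_apply, hx,
              smul_zero, smul_zero]
          | mem x hx =>
            obtain ⟨b, rfl⟩ := hx
            apply alt_ext
            intro v
            have h1 := hG b (Fin.cons b v)
            have e : (fun i => D S A ((Fin.cons b v : Fin (n + 1) → A) i)) =
                Matrix.vecCons (D S A b) fun i => D S A (v i) := by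
              funext i
              refine Fin.cases ?_ (fun i => ?_) i <;> rfl
            rw [e] at h1
            simp only [AlternatingMap.curryLeft_apply_apply, hT, h1, AlternatingMap.zero_apply]
            exact f.map_eq_zero_of_eq _ (i := 0) (j := 1) (by simp [Matrix.vecCons]) (by simp)
        have same' : ∀ x (u : Fin n → Ω[A⁄S]), T x (Fin.cons x u) = 0 := fun x u =>
          congrArg (fun F => F u) (same x)
        intro x w j hj
        rcases eq_or_ne j 0 with rfl | hj0
        · rw [← Fin.cons_self_tail w, hj]
          exact same' x _
        · have h := (T x).map_swap w hj0
          have h1 : (w ∘ Equiv.swap j 0) 0 = x := by simp [hj]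
          rw [← Fin.cons_self_tail (w ∘ Equiv.swap j 0), h1, same'] at h
          rw [← neg_eq_zero, ← h]
    refine ⟨⟨LinearMap.uncurryLeft (AlternatingMap.toMultilinearMapLM (S := A) ∘ₗ T), ?_⟩, ?_⟩
    · have hu : ∀ c w, (LinearMap.uncurryLeft (AlternatingMap.toMultilinearMapLM (S := A) ∘ₗ T)
          : MultilinearMap A (fun _ : Fin (n + 1) => Ω[A⁄S]) A) (Fin.cons c w) = T c w := by
        intro c w; rfl
      intro v i j hij hne
      induction v using Fin.consCases with
      | _ c w =>
      simp only [MultilinearMap.toFun_eq_coe]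
      rw [hu]
      induction i using Fin.cases with
      | zero =>
        induction j using Fin.cases with
        | zero => exact absurd rfl hne
        | succ j => exact hz c w j hij.symm
      | succ i =>
        induction j using Fin.cases with
        | zero => exact hz c w i hij
        | succ j => exact AlternatingMap.map_eq_zero_of_eq _ w hij (fun h => hne (congrArg _ h))
    · intro v
      change T (D S A (v 0)) (fun i => D S A (v i.succ)) = f v
      rw [hT, hG, AlternatingMap.curryLeft_apply_apply]
      congr 1
      exact Fin.cons_self_tail v

lemma exists_polyvector {n : ℕ} (f : A [⋀^Fin n]→ₗ[S] A) (hf : IsMultiDer f) :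
    ∃ g : Polyvector S A n, g.toAlt = f := by
  obtain ⟨g, hg⟩ := exists_lift f hf
  refine ⟨exteriorPower.alternatingMapLinearEquiv g, ?_⟩
  ext v
  simpa using hg v

/-- The polyvector field with a prescribed alternating multiderivation. -/
noncomputable def Polyvector.ofAlt {n : ℕ} (f : A [⋀^Fin n]→ₗ[S] A) (hf : IsMultiDer f) :
    Polyvector S A n := (exists_polyvector f hf).choose

@[simp] lemma Polyvector.toAlt_ofAlt {n : ℕ} (f : A [⋀^Fin n]→ₗ[S] A) (hf : IsMultiDer f) :
    (Polyvector.ofAlt f hf).toAlt = f := (exists_polyvector f hf).choose_spec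

lemma Polyvector.toAlt_injective {n : ℕ} :
    Function.Injective (Polyvector.toAlt : Polyvector S A n → _) :=
  fun f g h => Polyvector.ext' fun v => by rw [h]

namespace PoissonBracket

variable (P : PoissonBracket S A)

/-- The Lichnerowicz–Poisson differential `δ : ⋀ⁿ Θ_{A/S} → ⋀ⁿ⁺¹ Θ_{A/S}`. -/
noncomputable def delta (n : ℕ) : Polyvector S A n →ₗ[S] Polyvector S A (n + 1) where
  toFun f := Polyvector.ofAlt (P.lpAlt f.toAlt) (P.isMultiDer_lpAlt _ f.isMultiDer_toAlt)
  map_add' f g := by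
    apply Polyvector.toAlt_injective
    have h : ∀ {n : ℕ} (f g : Polyvector S A n), (f + g).toAlt = f.toAlt + g.toAlt := by
      intro n f g; ext v; rfl
    rw [h (Polyvector.ofAlt _ _), Polyvector.toAlt_ofAlt, Polyvector.toAlt_ofAlt,
      Polyvector.toAlt_ofAlt, h, lpAlt_add]
  map_smul' s f := by
    apply Polyvector.toAlt_injective
    have h : ∀ {n : ℕ} (f : Polyvector S A n), (s • f).toAlt = s • f.toAlt := by
      intro n f; ext v; rfl
    rw [RingHom.id_apply, h (Polyvector.ofAlt _ _), Polyvector.toAlt_ofAlt,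
      Polyvector.toAlt_ofAlt, h, lpAlt_smul]

lemma toAlt_delta {n : ℕ} (f : Polyvector S A n) : (P.delta n f).toAlt = P.lpAlt f.toAlt :=
  Polyvector.toAlt_ofAlt _ (P.isMultiDer_lpAlt _ f.isMultiDer_toAlt)

/-- The defining formula of `δ`. -/
lemma delta_apply {n : ℕ} (f : Polyvector S A n) (a : Fin (n + 1) → A) :
    P.delta n f (exteriorPower.ιMulti A (n + 1) fun i => D S A (a i)) = P.lpFun f.toAlt a := by
  rw [← Polyvector.toAlt_apply, toAlt_delta, lpAlt_apply]

lemma delta_delta {n : ℕ} (f : Polyvector S A n) : P.delta (n + 1) (P.delta n f) = 0 := by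
  apply Polyvector.toAlt_injective
  rw [toAlt_delta, toAlt_delta, lpAlt_lpAlt]
  ext v
  rfl

end PoissonBracket
end Polyvector

section Functoriality

open KaehlerDifferential

variable {S A B C : Type} [CommRing S] [CommRing A] [CommRing B] [CommRing C] [Algebra S A]
  [Algebra S B] [Algebra S C]

lemma exists_formMap (φ : A →ₐ[S] B) (n : ℕ) : ∃ g : Form S A n →ₗ[S] Form S B n,
    ∀ (a : A) (b : Fin n → A), g (a • exteriorPower.ιMulti A n fun i => D S A (b i)) =
      φ a • exteriorPower.ιMulti B n fun i => D S B (φ (b i)) := by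
  let : Algebra A B := φ.toRingHom.toAlgebra
  have : IsScalarTower S A B := IsScalarTower.of_algebraMap_eq' φ.comp_algebraMap.symm
  have hs : ∀ (c : A) (y : Form S B n), c • y = algebraMap A B c • y := fun c y =>
    (algebraMap_smul B c y).symm
  let alt : Ω[A⁄S] [⋀^Fin n]→ₗ[A] Form S B n :=
    { toFun := fun v => exteriorPower.ιMulti B n fun i => KaehlerDifferential.map S S A B (v i)
      map_update_add' := by
        intro inst v i x y
        have : ∀ z, (fun j => KaehlerDifferential.map S S A B (Function.update v i z j)) =
            Function.update (fun j => KaehlerDifferential.map S S A B (v j)) i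
              (KaehlerDifferential.map S S A B z) :=
          fun z => funext fun j => Function.apply_update (fun _ => KaehlerDifferential.map S S A B) v i z j
        simp only [this, map_add, AlternatingMap.map_update_add]
      map_update_smul' := by
        intro inst v i c x
        have : ∀ z, (fun j => KaehlerDifferential.map S S A B (Function.update v i z j)) =
            Function.update (fun j => KaehlerDifferential.map S S A B (v j)) i
              (KaehlerDifferential.map S S A B z) :=
          fun z => funext fun j => Function.apply_update (fun _ => KaehlerDifferential.map S S A B) v i z j
        simp only [this, map_smul]
        rw [← algebraMap_smul B c (KaehlerDifferential.map S S A B x),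
          AlternatingMap.map_update_smul, hs]
      map_eq_zero_of_eq' := by
        intro v i j hij hne
        exact AlternatingMap.map_eq_zero_of_eq _ _ (by rw [hij]) hne }
  refine ⟨(exteriorPower.alternatingMapLinearEquiv alt).restrictScalars S, fun a b => ?_⟩
  rw [LinearMap.restrictScalars_apply, map_smul,
    exteriorPower.alternatingMapLinearEquiv_apply_ιMulti, hs]
  simp only [alt, AlternatingMap.coe_mk, MultilinearMap.coe_mk, KaehlerDifferential.map_D]
  rfl

/-- Pullback of forms along a homomorphism of `S`-algebras:
`a db₁ ∧ … ∧ dbₙ ↦ φ(a) dφ(b₁) ∧ … ∧ dφ(bₙ)`. -/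
noncomputable def formMap (φ : A →ₐ[S] B) (n : ℕ) : Form S A n →ₗ[S] Form S B n :=
  (exists_formMap φ n).choose

lemma formMap_gen (φ : A →ₐ[S] B) {n : ℕ} (a : A) (b : Fin n → A) :
    formMap φ n (a • exteriorPower.ιMulti A n fun i => D S A (b i)) =
      φ a • exteriorPower.ιMulti B n fun i => D S B (φ (b i)) :=
  (exists_formMap φ n).choose_spec a b

lemma formMap_gen' (φ : A →ₐ[S] B) {n : ℕ} (b : Fin n → A) :
    formMap φ n (exteriorPower.ιMulti A n fun i => D S A (b i)) =
      exteriorPower.ιMulti B n fun i => D S B (φ (b i)) := by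
  simpa using formMap_gen φ 1 b

lemma formMap_formD (φ : A →ₐ[S] B) {n : ℕ} (x : Form S A n) :
    formMap φ (n + 1) (formD S A n x) = formD S B n (formMap φ n x) := by
  induction x using form_induction with
  | gen a b =>
    rw [formD_gen, formMap_gen', formMap_gen, formD_gen]
    congr 1
    funext i
    refine Fin.cases ?_ (fun i => ?_) i <;> rfl
  | add x y hx hy => simp only [map_add, hx, hy]

/-- Compatibility of polyvector fields under a homomorphism of `S`-algebras. -/
def Polyvector.Compatible (φ : A →ₐ[S] B) {n : ℕ} (f : Polyvector S A n) (g : Polyvector S B n) :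
    Prop :=
  ∀ η : Form S A n, g (formMap φ n η) = φ (f η)

lemma Polyvector.compatible_iff (φ : A →ₐ[S] B) {n : ℕ} (f : Polyvector S A n)
    (g : Polyvector S B n) : Polyvector.Compatible φ f g ↔
      ∀ a : Fin n → A, g.toAlt (fun i => φ (a i)) = φ (f.toAlt a) := by
  constructor
  · intro h a
    rw [toAlt_apply, toAlt_apply, ← formMap_gen', h]
  · intro h η
    induction η using form_induction with
    | gen a b =>
      have := h b
      rw [toAlt_apply, toAlt_apply] at this
      rw [formMap_gen, map_smul, map_smul, this, smul_eq_mul, smul_eq_mul, map_mul]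
    | add x y hx hy => simp only [map_add, hx, hy]

lemma compatible_delta (φ : A →ₐ[S] B) (P : PoissonBracket S A) (Q : PoissonBracket S B)
    (h : ∀ a b, Q.br (φ a) (φ b) = φ (P.br a b)) {n : ℕ} (f : Polyvector S A n)
    (g : Polyvector S B n) (hfg : Polyvector.Compatible φ f g) :
    Polyvector.Compatible φ (P.delta n f) (Q.delta n g) := by
  rw [Polyvector.compatible_iff] at hfg ⊢
  intro a
  rw [PoissonBracket.toAlt_delta, PoissonBracket.toAlt_delta]
  simp only [PoissonBracket.lpAlt_apply, PoissonBracket.lpFun, map_add, map_sum, map_mul, map_pow,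
    map_neg, map_one]
  have h1 : ∀ j : Fin (n + 1), j.removeNth (fun i => φ (a i)) = fun i => φ (j.removeNth a i) :=
    fun j => rfl
  have h2 : ∀ (j : Fin (n + 1)) (z : A), Function.update (fun i => φ (a i)) j (φ z) =
      fun i => φ (Function.update a j z i) :=
    fun j z => funext fun i => (Function.apply_update (fun _ => φ) a j z i).symm
  have h3 : ∀ (j : Fin (n + 1)) (b : Fin (n + 1) → A),
      j.removeNth (fun i => φ (b i)) = fun i => φ (j.removeNth b i) :=
    fun j b => rfl
  simp only [h, h1, h2, h3, hfg]
  congr! with j _ k _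
  split_ifs <;> simp

end Functoriality

section Sheaf

open CategoryTheory AlgebraicGeometry TopologicalSpace Opposite KaehlerDifferential

variable {S : Type} [CommRing S] {X : Scheme.{0}} (π : X ⟶ Spec (CommRingCat.of S))

/-- The ring `Γ(U, 𝒪_X)`, as an algebra over `S` through `π : X ⟶ Spec S`. -/
def Sec (_ : X ⟶ Spec (CommRingCat.of S)) (U : X.Opens) : Type := Γ(X, U)

noncomputable instance (U : X.Opens) : CommRing (Sec π U) := inferInstanceAs (CommRing Γ(X, U))

noncomputable instance (U : X.Opens) : Algebra S (Sec π U) :=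
  RingHom.toAlgebra
    ((Scheme.ΓSpecIso (CommRingCat.of S)).inv ≫ π.appLE ⊤ U le_top).hom

/-- Restriction of functions. -/
noncomputable def Sec.res {U V : X.Opens} (h : U ≤ V) : Sec π V →ₐ[S] Sec π U where
  toRingHom := (X.presheaf.map (homOfLE h).op).hom
  commutes' s := by
    have : ((Scheme.ΓSpecIso (CommRingCat.of S)).inv ≫ π.appLE ⊤ V le_top) ≫
        X.presheaf.map (homOfLE h).op =
        (Scheme.ΓSpecIso (CommRingCat.of S)).inv ≫ π.appLE ⊤ U le_top := by
      rw [Category.assoc]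
      congr 1
      exact Scheme.Hom.appLE_map π _ _
    exact congrArg (fun F => F.hom s) this

/-- The affine open subsets of `U`. -/
abbrev AffineIn (U : X.Opens) : Type := {V : X.Opens // IsAffineOpen V ∧ V ≤ U}

/-- Sections over `U` of the sheaf `Ωⁿ_{X/T}`: compatible families of elements
of `Ωⁿ_{Γ(V)/S}`, for `V ⊆ U` affine open.  This is the quasi-coherent sheaf, extended from the
base of affine open sets; for `U` affine a section over `U` is just an element of
`Ωⁿ_{Γ(U)/S}`. -/
noncomputable def formSections (n : ℕ) (U : X.Opens) :
    Submodule S (∀ V : AffineIn U, Form S (Sec π V.1) n) where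
  carrier := {η | ∀ (V W : AffineIn U) (h : W.1 ≤ V.1), formMap (Sec.res π h) n (η V) = η W}
  zero_mem' V W h := by simp
  add_mem' hx hy V W h := by simp [hx V W h, hy V W h]
  smul_mem' s x hx V W h := by simp [hx V W h]

/-- Sections over `U` of the sheaf `⋀ⁿ Θ_{X/T} = Hom(Ωⁿ_{X/T}, 𝒪_X)`: compatible families
of elements of `Hom(Ωⁿ_{Γ(V)/S}, Γ(V))`, for `V ⊆ U` affine open. -/
noncomputable def polyvectorSections (n : ℕ) (U : X.Opens) :
    Submodule S (∀ V : AffineIn U, Polyvector S (Sec π V.1) n) where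
  carrier := {f | ∀ (V W : AffineIn U) (h : W.1 ≤ V.1),
    Polyvector.Compatible (Sec.res π h) (f V) (f W)}
  zero_mem' V W h η := by simp
  add_mem' hx hy V W h η := by simp [hx V W h η, hy V W h η]
  smul_mem' s x hx V W h η := by simp [hx V W h η]

variable {π} in
/-- The inclusion of affine opens of a smaller open set. -/
abbrev AffineIn.incl {U U' : X.Opens} (h : U' ≤ U) (V : AffineIn U') : AffineIn U :=
  ⟨V.1, V.2.1, V.2.2.trans h⟩

/-- Restriction of sections of `Ωⁿ_{X/T}`. -/
noncomputable def formSections.res (n : ℕ) {U U' : X.Opens} (h : U' ≤ U) :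
    formSections π n U →ₗ[S] formSections π n U' :=
  LinearMap.restrict (LinearMap.pi fun V => LinearMap.proj (V.incl h) :
      (∀ V : AffineIn U, Form S (Sec π V.1) n) →ₗ[S] ∀ V : AffineIn U', Form S (Sec π V.1) n)
    fun _ hη V W h' => hη (V.incl h) (W.incl h) h'

/-- Restriction of sections of `⋀ⁿ Θ_{X/T}`. -/
noncomputable def polyvectorSections.res (n : ℕ) {U U' : X.Opens} (h : U' ≤ U) :
    polyvectorSections π n U →ₗ[S] polyvectorSections π n U' :=
  LinearMap.restrict (LinearMap.pi fun V => LinearMap.proj (V.incl h) :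
      (∀ V : AffineIn U, Polyvector S (Sec π V.1) n) →ₗ[S]
        ∀ V : AffineIn U', Polyvector S (Sec π V.1) n)
    fun _ hη V W h' => hη (V.incl h) (W.incl h) h'

/-- The sheaf `Ωⁿ_{X/T}` of `S`-modules. -/
noncomputable def formSheaf (n : ℕ) : (Opens X)ᵒᵖ ⥤ ModuleCat.{0} S where
  obj U := ModuleCat.of S (formSections π n U.unop)
  map i := ModuleCat.ofHom (formSections.res π n i.unop.le)
  map_id _ := rfl
  map_comp _ _ := rfl

/-- The sheaf `⋀ⁿ Θ_{X/T}` of `S`-modules. -/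
noncomputable def polyvectorSheaf (n : ℕ) : (Opens X)ᵒᵖ ⥤ ModuleCat.{0} S where
  obj U := ModuleCat.of S (polyvectorSections π n U.unop)
  map i := ModuleCat.ofHom (polyvectorSections.res π n i.unop.le)
  map_id _ := rfl
  map_comp _ _ := rfl

/-- The exterior derivative on sections of `Ωⁿ_{X/T}`. -/
noncomputable def formSections.d (n : ℕ) (U : X.Opens) :
    formSections π n U →ₗ[S] formSections π (n + 1) U :=
  LinearMap.restrict (LinearMap.pi fun V => (formD S (Sec π V.1) n).comp (LinearMap.proj V) :
      (∀ V : AffineIn U, Form S (Sec π V.1) n) →ₗ[S]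
        ∀ V : AffineIn U, Form S (Sec π V.1) (n + 1))
    fun η hη V W h => by
      have := hη V W h
      simp only [LinearMap.pi_apply, LinearMap.comp_apply, LinearMap.proj_apply, formMap_formD,
        this]

/-- The exterior derivative `d : Ωⁿ_{X/T} → Ωⁿ⁺¹_{X/T}`. -/
noncomputable def formSheafD (n : ℕ) : formSheaf π n ⟶ formSheaf π (n + 1) where
  app U := ModuleCat.ofHom (formSections.d π n U.unop)
  naturality _ _ _ := rfl

lemma formSheafD_comp (n : ℕ) : formSheafD π n ≫ formSheafD π (n + 1) = 0 := by
  ext U x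
  apply Subtype.ext
  funext V
  exact formD_formD _

/-- A Poisson structure on the `T`-scheme `X`, `T = Spec S`: an `S`-linear Poisson bracket on the
sheaf `𝒪_X`. -/
structure PoissonStructure where
  bracket (U : X.Opens) : PoissonBracket S (Sec π U)
  res {U V : X.Opens} (h : U ≤ V) (a b : Sec π V) :
    (bracket U).br (Sec.res π h a) (Sec.res π h b) = Sec.res π h ((bracket V).br a b)

variable {π} (P : PoissonStructure π)

/-- The Lichnerowicz–Poisson differential on sections of `⋀ⁿ Θ_{X/T}`. -/
noncomputable def PoissonStructure.deltaSections (n : ℕ) (U : X.Opens) :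
    polyvectorSections π n U →ₗ[S] polyvectorSections π (n + 1) U :=
  LinearMap.restrict (LinearMap.pi fun V => ((P.bracket V.1).delta n).comp (LinearMap.proj V) :
      (∀ V : AffineIn U, Polyvector S (Sec π V.1) n) →ₗ[S]
        ∀ V : AffineIn U, Polyvector S (Sec π V.1) (n + 1))
    fun _ hf V W h => compatible_delta _ _ _ (P.res h) _ _ (hf V W h)

/-- The Lichnerowicz–Poisson differential `δ : ⋀ⁿ Θ_{X/T} → ⋀ⁿ⁺¹ Θ_{X/T}`. -/
noncomputable def PoissonStructure.delta (n : ℕ) :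
    polyvectorSheaf π n ⟶ polyvectorSheaf π (n + 1) where
  app U := ModuleCat.ofHom (P.deltaSections n U.unop)
  naturality _ _ _ := rfl

lemma PoissonStructure.delta_comp (n : ℕ) : P.delta n ≫ P.delta (n + 1) = 0 := by
  ext U x
  apply Subtype.ext
  funext V
  exact (P.bracket V.1).delta_delta _

open Limits ZeroObject in
/-- The complex `0 → M₁ → M₂ → …`, with `Mₙ` in degree `n ≥ 1` and `0` in degree `0`. -/
noncomputable def complexGeOne {C : Type*} [Category C] [HasZeroMorphisms C] [HasZeroObject C]
    (M : ℕ → C) (d : ∀ n, M n ⟶ M (n + 1)) (h : ∀ n, d n ≫ d (n + 1) = 0) : CochainComplex C ℕ :=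
  CochainComplex.of (fun | 0 => 0 | n + 1 => M (n + 1)) (fun | 0 => 0 | n + 1 => d (n + 1))
    (fun | 0 => zero_comp | n + 1 => h (n + 1))

variable (π) in
/-- The truncated relative de Rham complex `(Ω^{≥1}_{X/T}, d)`. -/
noncomputable def deRhamGeOne : CochainComplex ((Opens X)ᵒᵖ ⥤ ModuleCat.{0} S) ℕ :=
  complexGeOne (formSheaf π) (formSheafD π) (formSheafD_comp π)

/-- The Lichnerowicz–Poisson complex `(⋀^• Θ_{X/T}, δ)`, in degrees `≥ 1`. -/
noncomputable def PoissonStructure.lichnerowicz :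
    CochainComplex ((Opens X)ᵒᵖ ⥤ ModuleCat.{0} S) ℕ :=
  complexGeOne (polyvectorSheaf π) P.delta P.delta_comp

variable (X S) in
/-- The passage from complexes of presheaves of `S`-modules on `X` to complexes in the abelian
category of sheaves of `S`-modules, in which quasi-isomorphisms are taken. -/
noncomputable def sheafifyComplex : CochainComplex ((Opens X)ᵒᵖ ⥤ ModuleCat.{0} S) ℕ ⥤
    CochainComplex (CategoryTheory.Sheaf (Opens.grothendieckTopology X) (ModuleCat.{0} S)) ℕ :=
  (presheafToSheaf (Opens.grothendieckTopology X) (ModuleCat.{0} S)).mapHomologicalComplex _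

/-- The map on sections over `U`, in degree `n + 1`, of a morphism from the Lichnerowicz–Poisson
complex to the truncated de Rham complex. -/
noncomputable def PoissonStructure.component (φ : P.lichnerowicz ⟶ deRhamGeOne π) (n : ℕ)
    (U : X.Opens) : polyvectorSections π (n + 1) U →ₗ[S] formSections π (n + 1) U :=
  ((φ.f (n + 1)).app (op U)).hom

/-- The value of a section of `Ωⁿ_{X/T}` on an affine open subset. -/
def formOn {n : ℕ} {U : X.Opens} (η : formSections π n U) (V : AffineIn U) :
    Form S (Sec π V.1) n := η.1 V

/-- The value of a section of `⋀ⁿ Θ_{X/T}` on an affine open subset. -/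
def polyvectorOn {n : ℕ} {U : X.Opens} (f : polyvectorSections π n U)
    (V : AffineIn U) : Polyvector S (Sec π V.1) n := f.1 V

end Sheaf

section Symplectic

open CategoryTheory AlgebraicGeometry KaehlerDifferential TensorProduct

variable {S A : Type} [CommRing S] [CommRing A] [Algebra S A]

/-- The polyvector field `v₁ ∧ … ∧ vₙ` of vector fields `vᵢ`: its value on `η₁ ∧ … ∧ ηₙ` is
`det (vᵢ(ηⱼ))`. -/
noncomputable def Polyvector.wedge {n : ℕ} (v : Fin n → Derivation S A A) : Polyvector S A n :=
  exteriorPower.pairingDual A Ω[A⁄S] n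
    (exteriorPower.ιMulti A n fun i => (v i).liftKaehlerDifferential)

/-- The value `η(v₁, …, vₙ)` of an `n`-form on vector fields. -/
noncomputable def Form.eval {n : ℕ} (η : Form S A n) (v : Fin n → Derivation S A A) : A :=
  Polyvector.wedge v η

/-- The contraction `v ⌟ η`, so `v ⌟ (α ∧ β) = α(v) β - β(v) α` for `1`-forms `α`, `β`. -/
noncomputable def contract (v : Derivation S A A) (η : FormAlg S A) : FormAlg S A :=
  CliffordAlgebra.contractLeft (v.liftKaehlerDifferential : Module.Dual A Ω[A⁄S]) η

/-- The exterior power `ω ∧ … ∧ ω` (`d` factors) of a `2`-form. -/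
noncomputable def Form.twoPow (ω : Form S A 2) (d : ℕ) : Form S A (d * 2) :=
  ⟨(ω : FormAlg S A) ^ d, SetLike.pow_mem_graded (A := fun n => ⋀[A]^n Ω[A⁄S]) d ω.2⟩

/-- The image of an `n`-form in the fibre of `Ωⁿ` at a point. -/
noncomputable def Form.atPoint {n : ℕ} (η : Form S A n) (p : PrimeSpectrum A) :
    p.asIdeal.ResidueField ⊗[A] Form S A n := 1 ⊗ₜ η

/-- `h` is the Hamiltonian vector field of `a` for the `2`-form `ω`: it corresponds to `da` under
`ω`, that is `ω(v, h) = da(v)` for all vector fields `v`. -/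
def IsHamiltonian (ω : Form S A 2) (a : A) (h : Derivation S A A) : Prop :=
  ∀ v : Derivation S A A, ω.eval ![v, h] = v a

variable {X₀ X : Scheme.{0}}

/-- `X₀` is a symplectic manifold of dimension `2d` with symplectic form `ω₀`: a non-singular
variety over `ℂ`, with a closed global `2`-form whose `d`-th exterior power vanishes nowhere. -/
structure IsSymplecticManifold (π₀ : X₀ ⟶ Spec (CommRingCat.of ℂ)) (d : ℕ)
    (ω₀ : formSections π₀ 2 ⊤) : Prop where
  integral : IsIntegral X₀
  separated : IsSeparated π₀
  locallyOfFiniteType : LocallyOfFiniteType π₀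
  quasiCompact : QuasiCompact π₀
  smooth : SmoothOfRelativeDimension (d * 2) π₀
  closed : formSections.d π₀ 2 ⊤ ω₀ = 0
  nowhere_vanishing (V : AffineIn (⊤ : X₀.Opens)) (p : PrimeSpectrum (Sec π₀ V.1)) :
    ((formOn ω₀ V).twoPow d).atPoint p ≠ 0

/-- The Poisson structure is the one defined by the `2`-form `ω`: `{a, b} = ω(H_a, H_b)`. -/
def PoissonStructure.IsInducedBy {π : X ⟶ Spec (CommRingCat.of S)} (P : PoissonStructure π)
    (ω : formSections π 2 ⊤) : Prop :=
  ∀ (V : AffineIn (⊤ : X.Opens)) (a b : Sec π V.1) (ha hb : Derivation S (Sec π V.1) (Sec π V.1)),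
    IsHamiltonian (formOn ω V) a ha → IsHamiltonian (formOn ω V) b hb →
      (P.bracket V.1).br a b = (formOn ω V).eval ![ha, hb]

/-- Pullback of functions along `i`. -/
noncomputable def Sec.pull {S' : Type} [CommRing S'] (π₀ : X₀ ⟶ Spec (CommRingCat.of S'))
    (π : X ⟶ Spec (CommRingCat.of S)) (i : X₀ ⟶ X) (U : X.Opens) :
    Sec π U →+* Sec π₀ (i ⁻¹ᵁ U) := (i.app U).hom

/-- `(X, P)` is a Poisson deformation over `Spec S` of the Poisson scheme `(X₀, P₀)` over `ℂ`:
`X` is flat over `Spec S`, and the morphism `i` identifies `X₀`, with its bracket, with the fibre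
of `X` over the closed point `ρ : S → ℂ`. -/
structure IsPoissonDeformation [Algebra ℂ S] (ρ : S →ₐ[ℂ] ℂ)
    {π₀ : X₀ ⟶ Spec (CommRingCat.of ℂ)} (P₀ : PoissonStructure π₀)
    {π : X ⟶ Spec (CommRingCat.of S)} (P : PoissonStructure π) (i : X₀ ⟶ X) : Prop where
  flat : Flat π
  isPullback : IsPullback i π₀ π (Spec.map (CommRingCat.ofHom ρ.toRingHom))
  bracket (U : X.Opens) (a b : Sec π U) :
    (P₀.bracket (i ⁻¹ᵁ U)).br (Sec.pull π₀ π i U a) (Sec.pull π₀ π i U b) =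
      Sec.pull π₀ π i U ((P.bracket U).br a b)

end Symplectic
end PoissonDeRham

/-!
Everything is decided on affine open subsets `V` of `X`, by means of the linear map
`♯ : Ω → Ω*`, `da ↦ H_a` (`PoissonBracket.sharp`) on `Ω = Ω_{Γ(V)/S}`. Call the bracket
nondegenerate if `♯` has a *frame*: finite families `xᵢ`, `yᵢ` in `Ω` with
`z = ∑ i, ♯(yᵢ)(z) xᵢ` for all `z` (`IsFrame`). A frame makes `♯` bijective and exhibits `Ω` as
finite projective.

On the symplectic manifold `X₀` the bracket is nondegenerate (`nondegenerate_of_symplectic`):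
`Ω` is finite projective there, `⋀^{2d+1} Ω = 0`, and contracting `x ∧ ω₀ᵈ = 0` with a functional
shows that a degenerate direction at a point would force `ω₀ᵈ` to vanish there
(`flat_surjective`). A frame on the closed fibre lifts to `X` by the nilpotence of the maximal
ideal: lift the families arbitrarily; then `z ↦ ∑ i, ♯(yᵢ)(z) xᵢ` is the identity modulo a nilpotent
ideal, hence invertible, and the `xᵢ` can be corrected by its inverse
(`nondegenerate_of_reduction`). In particular `Ω_{X/T}` is locally free, as a consequence of
nondegeneracy alone.

A nondegenerate bracket induces isomorphisms `⋀ⁿ Ω ≃ Hom(⋀ⁿ Ω, A)`,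
`η ↦ ((a₁, …, aₙ) ↦ η(H_{a₁}, …, H_{aₙ}))` (`IsFrame.bijective_raise`; `n!` is invertible). The
inverses are the components of `φ`, and `ω` is the form that corresponds to the Poisson bivector.
These maps commute with the differentials (`PoissonBracket.delta_toPolyvector`), because both
differentials are determined by Lie derivatives through Cartan's formula; so `dω = 0` expresses the
Jacobi identity. They are compatible with restriction to a smaller affine open subset, because
differentials of restricted functions generate there (`span_D_res`), and therefore they glue.
-/

namespace PoissonDeRham

open KaehlerDifferential

/-! ### Alternating pairings with a symplectic frame -/

section Frames

variable {A M N ι : Type*} [CommRing A] [AddCommGroup M] [Module A M] [AddCommGroup N] [Module A N]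

lemma ιMulti_perm {n : ℕ} (x : ι → M) (I : Fin n → ι) (σ : Equiv.Perm (Fin n)) :
    exteriorPower.ιMulti A n (fun i => x ((I ∘ σ) i)) =
      Equiv.Perm.sign σ • exteriorPower.ιMulti A n fun i => x (I i) :=
  (exteriorPower.ιMulti A n).map_perm (fun i => x (I i)) σ

variable [Fintype ι]

/-- Summing `det (a (I j) i) • F I` over all multi-indices `I`, for `F` antisymmetric in `I`, gives
`n!` times the contribution of the diagonal term of the determinant. -/
lemma sum_det_smul {n : ℕ} (a : ι → Fin n → A) (F : (Fin n → ι) → N)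
    (hF : ∀ (I : Fin n → ι) (σ : Equiv.Perm (Fin n)), F (I ∘ σ) = Equiv.Perm.sign σ • F I) :
    ∑ I : Fin n → ι, (Matrix.of fun i j => a (I j) i).det • F I =
      (n.factorial : A) • ∑ I : Fin n → ι, (∏ j, a (I j) j) • F I := by
  classical
  have h : ∀ σ : Equiv.Perm (Fin n),
      ∑ I : Fin n → ι, ((Equiv.Perm.sign σ : ℤ) * ∏ j, a (I j) (σ j) : A) • F I =
        ∑ I : Fin n → ι, (∏ j, a (I j) j) • F I := by
    intro σ
    rw [← (Equiv.arrowCongr σ (Equiv.refl ι)).sum_comp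
      (fun I : Fin n → ι => (∏ j, a (I j) j) • F I)]
    refine Finset.sum_congr rfl fun I _ => ?_
    have e : (Equiv.arrowCongr σ (Equiv.refl ι)) I = I ∘ σ.symm := rfl
    rw [e, hF I σ.symm, Equiv.Perm.sign_symm, mul_smul,
      ← Equiv.prod_comp σ (fun j => a ((I ∘ σ.symm) j) j)]
    simp only [Function.comp_apply, Equiv.symm_apply_apply]
    rcases Int.units_eq_one_or (Equiv.Perm.sign σ) with h | h <;> simp [h]
  simp only [Matrix.det_apply', Finset.sum_smul, Matrix.of_apply]
  rw [Finset.sum_comm, Finset.sum_congr rfl fun σ _ => h σ, Finset.sum_const, Finset.card_univ,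
    Fintype.card_perm, Fintype.card_fin, Nat.cast_smul_eq_nsmul]

/-- Two families `x`, `y` with `z = ∑ i, ⟨yᵢ, z⟩ xᵢ` for all `z`, where `⟨u, v⟩ = B u v`. -/
def IsFrame (B : M →ₗ[A] Module.Dual A M) (x y : ι → M) : Prop :=
  ∀ z, ∑ i, B (y i) z • x i = z

variable {B : M →ₗ[A] Module.Dual A M} {x y : ι → M}

lemma IsFrame.injective (h : IsFrame B x y) (hB : ∀ u v, B u v = -B v u) :
    Function.Injective B := by
  rw [← LinearMap.ker_eq_bot, LinearMap.ker_eq_bot']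
  intro z hz
  rw [← h z]
  exact Finset.sum_eq_zero fun i _ => by rw [hB, hz]; simp

lemma IsFrame.surjective (h : IsFrame B x y) : Function.Surjective B := by
  intro f
  refine ⟨∑ i, f (x i) • y i, LinearMap.ext fun z => ?_⟩
  conv_rhs => rw [← h z]
  simp [mul_comm]

/-- Interchanging the two families of a frame changes a sign. -/
lemma IsFrame.swap (h : IsFrame B x y) (hB : ∀ u v, B u v = -B v u) (z : M) :
    ∑ i, B (x i) z • y i = -z := by
  apply h.injective hB
  ext w
  conv_rhs => rw [← h w]
  simp only [map_sum, map_smul, LinearMap.sum_apply, LinearMap.smul_apply, smul_eq_mul, map_neg,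
    LinearMap.neg_apply]
  exact Finset.sum_congr rfl fun i _ => by rw [hB (x i) z]; ring

/-- The map `⋀ⁿ M → (⋀ⁿ M)*` induced by `B : M → M*`. -/
noncomputable def raise (B : M →ₗ[A] Module.Dual A M) (n : ℕ) :
    (⋀[A]^n M) →ₗ[A] Module.Dual A (⋀[A]^n M) :=
  (exteriorPower.pairingDual A M n ∘ₗ exteriorPower.map n B).flip

lemma raise_ιMulti (B : M →ₗ[A] Module.Dual A M) {n : ℕ} (η : ⋀[A]^n M) (z : Fin n → M) :
    raise B n η (exteriorPower.ιMulti A n z) =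
      exteriorPower.pairingDual A M n (exteriorPower.ιMulti A n fun i => B (z i)) η := by
  simp only [raise, LinearMap.flip_apply, LinearMap.comp_apply, exteriorPower.map_apply_ιMulti]
  rfl

lemma raise_ιMulti_ιMulti (B : M →ₗ[A] Module.Dual A M) {n : ℕ} (w z : Fin n → M) :
    raise B n (exteriorPower.ιMulti A n w) (exteriorPower.ιMulti A n z) =
      (Matrix.of fun i j => B (z j) (w i)).det := by
  rw [raise_ιMulti, exteriorPower.pairingDual_ιMulti_ιMulti]

/-- Expansion of `f (z₁ ∧ … ∧ zₙ)` for `zⱼ = ∑ i, aᵢⱼ xᵢ`. -/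
lemma sum_prod_smul_ιMulti {n : ℕ} (a : ι → Fin n → A) (x : ι → M) :
    ∑ I : Fin n → ι, (∏ j, a (I j) j) • exteriorPower.ιMulti A n (fun j => x (I j)) =
      exteriorPower.ιMulti A n fun j => ∑ i, a i j • x i := by
  classical
  refine Eq.trans ?_ ((exteriorPower.ιMulti A n).toMultilinearMap.map_sum
    (fun (j : Fin n) i => a i j • x i)).symm
  exact Finset.sum_congr rfl fun I _ =>
    ((exteriorPower.ιMulti A n).map_smul_univ (fun j => a (I j) j) fun j => x (I j)).symm

/-- A frame induces an inverse of `⋀ⁿ M → (⋀ⁿ M)*`, because `n!` is invertible. -/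
lemma IsFrame.bijective_raise (h : IsFrame B x y) (hB : ∀ u v, B u v = -B v u) {n : ℕ}
    (hn : IsUnit (n.factorial : A)) : Function.Bijective (raise B n) := by
  obtain ⟨c, hc⟩ := hn.exists_left_inv
  have hneg : ∀ v : Fin n → M, (exteriorPower.ιMulti A n fun j => -v j) =
      (-1 : A) ^ n • exteriorPower.ιMulti A n v := by
    intro v
    have := (exteriorPower.ιMulti A n).map_smul_univ (fun _ => (-1 : A)) v
    simpa using this
  have hsq : (-1 : A) ^ n * (-1) ^ n = 1 := by rw [← mul_pow]; simp
  constructor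
  · -- contraction with the frame recovers `η` from `raise B n η`
    have key : ∀ η : ⋀[A]^n M, ∑ I : Fin n → ι,
        raise B n η (exteriorPower.ιMulti A n fun j => x (I j)) •
          exteriorPower.ιMulti A n (fun j => y (I j)) = ((n.factorial : A) * (-1) ^ n) • η := by
      intro η
      have e : (∑ I : Fin n → ι, LinearMap.smulRight
          ((raise B n).flip (exteriorPower.ιMulti A n fun j => x (I j)))
          (exteriorPower.ιMulti A n (fun j => y (I j)))) =
          ((n.factorial : A) * (-1) ^ n) • LinearMap.id := by
        apply exteriorPower.linearMap_ext
        ext1 w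
        simp only [LinearMap.compAlternatingMap_apply, LinearMap.sum_apply,
          LinearMap.smulRight_apply, LinearMap.flip_apply, raise_ιMulti_ιMulti,
          LinearMap.smul_apply, LinearMap.id_apply]
        rw [sum_det_smul (fun i k => B (x i) (w k)) _ (ιMulti_perm y),
          sum_prod_smul_ιMulti (fun i k => B (x i) (w k)) y]
        simp only [h.swap hB, hneg, smul_smul]
      simpa using congrArg (fun F => F η) e
    rw [← LinearMap.ker_eq_bot, LinearMap.ker_eq_bot']
    intro η hη
    have := key η
    rw [hη] at this
    simp only [LinearMap.zero_apply, zero_smul, Finset.sum_const_zero] at this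
    have h2 := congrArg (fun z => (c * (-1) ^ n) • z) this
    simp only [smul_zero, smul_smul] at h2
    rw [show c * (-1) ^ n * (↑n.factorial * (-1) ^ n) = (c * n.factorial) * ((-1) ^ n * (-1) ^ n) by
      ring, hc, hsq, one_mul, one_smul] at h2
    exact h2.symm
  · intro f
    refine ⟨(c * (-1) ^ n) • ∑ I : Fin n → ι, f (exteriorPower.ιMulti A n fun j => x (I j)) •
      exteriorPower.ιMulti A n (fun j => y (I j)), ?_⟩
    apply exteriorPower.linearMap_ext
    ext1 z
    simp only [LinearMap.compAlternatingMap_apply, map_smul, map_sum, LinearMap.smul_apply,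
      LinearMap.sum_apply, raise_ιMulti_ιMulti]
    have e : ∀ I : Fin n → ι, (Matrix.of fun i j => B (z j) (y (I i))).det =
        (-1) ^ n * (Matrix.of fun i j => B (y (I j)) (z i)).det := by
      intro I
      have : (Matrix.of fun i j => B (z j) (y (I i))) =
          -(Matrix.of fun i j => B (y (I j)) (z i)).transpose := by
        ext i j
        simp [hB (z j)]
      rw [this, Matrix.det_neg, Matrix.det_transpose, Fintype.card_fin]
    have e2 := sum_det_smul (fun i k => B (y i) (z k))
      (fun I => f (exteriorPower.ιMulti A n fun j => x (I j)))
      (fun I σ => by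
        have := congrArg f (ιMulti_perm x I σ)
        rw [Units.smul_def, map_zsmul] at this
        simpa [Units.smul_def] using this)
    have e3 := congrArg f (sum_prod_smul_ιMulti (fun i k => B (y i) (z k)) x)
    simp only [h _, map_sum, map_smul] at e3
    rw [e3] at e2
    simp only [smul_eq_mul, e] at e2 ⊢
    calc _ = c * ((-1) ^ n * (-1) ^ n) * ∑ I : Fin n → ι,
          ((Matrix.of fun i j => B (y (I j)) (z i)).det *
            f (exteriorPower.ιMulti A n fun j => x (I j))) := by
          simp only [Finset.mul_sum]
          exact Finset.sum_congr rfl fun I _ => by ring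
      _ = _ := by rw [hsq, mul_one, e2, ← mul_assoc, hc, one_mul]

/-- An endomorphism which is the identity modulo a nilpotent ideal is bijective. -/
lemma bijective_of_sub_mem_smul_top {J : Ideal A} (hJ : IsNilpotent J) (T : M →ₗ[A] M)
    (hT : ∀ z, T z - z ∈ J • (⊤ : Submodule A M)) : Function.Bijective T := by
  obtain ⟨k, hk⟩ := hJ
  set N : Module.End A M := T - 1 with hN
  have hstep : ∀ (m : ℕ) (z : M), (N ^ m) z ∈ J ^ m • (⊤ : Submodule A M) := by
    intro m
    induction m with
    | zero => intro z; simp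
    | succ m ih =>
      intro z
      rw [pow_succ' N, Module.End.mul_apply]
      have h1 : ∀ u ∈ J ^ m • (⊤ : Submodule A M), N u ∈ J ^ (m + 1) • (⊤ : Submodule A M) := by
        intro u hu
        have h2 : N u ∈ (J ^ m • (⊤ : Submodule A M)).map N := ⟨u, hu, rfl⟩
        rw [Submodule.map_smul''] at h2
        rw [pow_succ, Submodule.mul_smul]
        refine Submodule.smul_mono le_rfl ?_ h2
        rintro _ ⟨v, _, rfl⟩
        exact hT v
      exact h1 _ (ih z)
  have hnil : IsNilpotent N := ⟨k, LinearMap.ext fun z => by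
    have := hstep k z
    rw [hk] at this
    simpa using this⟩
  have hu : IsUnit T := by
    have := hnil.isUnit_one_add
    rwa [hN, add_sub_cancel] at this
  exact (Module.End.isUnit_iff T).mp hu

/-- Families that form a frame modulo a nilpotent ideal can be corrected to a frame. -/
lemma exists_isFrame_of_nilpotent {J : Ideal A} (hJ : IsNilpotent J)
    (h : ∀ z, ∑ i, B (y i) z • x i - z ∈ J • (⊤ : Submodule A M)) :
    ∃ x' : ι → M, IsFrame B x' y := by
  let T : M →ₗ[A] M := ∑ i, (B (y i)).smulRight (x i)
  have hT : ∀ z, T z = ∑ i, B (y i) z • x i := fun z => by simp [T]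
  let e := LinearEquiv.ofBijective T (bijective_of_sub_mem_smul_top hJ T fun z => by
    rw [hT]; exact h z)
  refine ⟨fun i => e.symm (x i), fun z => e.injective ?_⟩
  simp only [map_sum, map_smul, LinearEquiv.apply_symm_apply]
  exact (hT z).symm

/-- If a finite projective module maps onto its dual by `B`, then it has a frame. -/
lemma exists_isFrame_of_surjective [Module.Finite A M] [Module.Projective A M]
    (hB : Function.Surjective B) : ∃ (m : ℕ) (x y : Fin m → M), IsFrame B x y := by
  obtain ⟨m, f, g, -, -, hfg⟩ := Module.Finite.exists_comp_eq_id_of_projective A M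
  choose y hy using fun i => hB ((LinearMap.proj i : (Fin m → A) →ₗ[A] A) ∘ₗ g)
  refine ⟨m, fun i => f (Pi.single i 1), y, fun z => ?_⟩
  simp only [hy, LinearMap.comp_apply, LinearMap.proj_apply, ← map_smul, ← map_sum]
  conv_rhs => rw [← LinearMap.id_apply (R := A) z, ← hfg, LinearMap.comp_apply]
  congr 1
  ext j
  simp [Finset.sum_apply, Pi.single_apply]

end Frames

/-! ### Nondegeneracy of a 2-form with nowhere vanishing top power -/

section Nondegenerate

variable {A M : Type*} [CommRing A] [AddCommGroup M] [Module A M]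

/-- More than `n` elements of a submodule generated by `n` elements have wedge product zero. -/
lemma ιMulti_eq_zero_of_mem_span {n : ℕ} (e : Fin n → M) (w : Fin (n + 1) → M)
    (hw : ∀ i, w i ∈ Submodule.span A (Set.range e)) : exteriorPower.ιMulti A (n + 1) w = 0 := by
  choose c hc using fun i => (Submodule.mem_span_range_iff_exists_fun A).mp (hw i)
  obtain rfl : w = fun j => ∑ i, c j i • e i := funext fun j => (hc j).symm
  rw [← sum_prod_smul_ιMulti (fun i j => c j i) e]
  refine Finset.sum_eq_zero fun I _ => ?_
  obtain ⟨i, j, hne, hij⟩ := Fintype.exists_ne_map_eq_of_card_lt I (by simp)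
  rw [AlternatingMap.map_eq_zero_of_eq _ _ (by rw [hij]) hne, smul_zero]

/-- If a module is generated by `n` elements locally on the spectrum, then its `(n+1)`-st exterior
power vanishes. -/
lemma subsingleton_exteriorPower_of_locally {n : ℕ} (s : Set A) (hs : Ideal.span s = ⊤)
    (h : ∀ t ∈ s, ∃ e : Fin n → M, ∀ z : M, ∃ k : ℕ, t ^ k • z ∈ Submodule.span A (Set.range e)) :
    Subsingleton (⋀[A]^(n + 1) M) := by
  have key : ∀ t ∈ s, ∀ η : ⋀[A]^(n + 1) M, ∃ k : ℕ, t ^ k • η = 0 := by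
    intro t ht η
    obtain ⟨e, he⟩ := h t ht
    choose k hk using he
    have hη : η ∈ Submodule.span A (Set.range (exteriorPower.ιMulti A (n + 1) (M := M))) := by
      rw [exteriorPower.ιMulti_span]; trivial
    induction hη using Submodule.span_induction with
    | mem x hx =>
      obtain ⟨w, rfl⟩ := hx
      refine ⟨∑ i, k (w i), ?_⟩
      have := (exteriorPower.ιMulti A (n + 1)).map_smul_univ (fun i => t ^ k (w i)) w
      rw [ιMulti_eq_zero_of_mem_span e _ fun i => hk (w i)] at this
      rw [← Finset.prod_pow_eq_pow_sum, this]
    | zero => exact ⟨0, smul_zero _⟩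
    | add x y _ _ hx hy =>
      obtain ⟨k, hk⟩ := hx
      obtain ⟨l, hl⟩ := hy
      refine ⟨k + l, ?_⟩
      rw [smul_add, pow_add, mul_smul, mul_smul, hl, smul_zero, add_zero, smul_comm, hk, smul_zero]
    | smul a x _ hx =>
      obtain ⟨k, hk⟩ := hx
      exact ⟨k, by rw [smul_comm, hk, smul_zero]⟩
  refine subsingleton_of_forall_eq 0 fun η => ?_
  let I : Ideal A := Submodule.colon ⊥ {η}
  have hI : ∀ a, a ∈ I ↔ a • η = 0 := fun a => by simp [I, Submodule.mem_colon_singleton]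
  have hrad : I.radical = ⊤ := by
    rw [eq_top_iff, ← hs, Ideal.span_le]
    intro t ht
    obtain ⟨k, hk⟩ := key t ht η
    exact ⟨k, (hI _).mpr hk⟩
  have h1 := (hI 1).mp ((Ideal.eq_top_iff_one _).mp (Ideal.radical_eq_top.mp hrad))
  simpa using h1

/-- Contraction is an antiderivation of the exterior algebra. -/
lemma contractLeft_mul (v : Module.Dual A M) (x y : ExteriorAlgebra A M) :
    CliffordAlgebra.contractLeft v (x * y) =
      CliffordAlgebra.contractLeft v x * y +
        CliffordAlgebra.involute x * CliffordAlgebra.contractLeft v y := by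
  induction x using ExteriorAlgebra.induction generalizing y with
  | algebraMap r =>
    have h1 := CliffordAlgebra.contractLeft_algebraMap_mul (Q := (0 : QuadraticForm A M)) v r y
    have h2 := CliffordAlgebra.contractLeft_algebraMap (Q := (0 : QuadraticForm A M)) v r
    rw [h1, h2, AlgHom.commutes, zero_mul, zero_add]
  | ι a =>
    have h1 := CliffordAlgebra.contractLeft_ι_mul (Q := (0 : QuadraticForm A M)) v a y
    have h2 := CliffordAlgebra.contractLeft_ι (Q := (0 : QuadraticForm A M)) v a
    simp only [ExteriorAlgebra.ι, h1, h2, CliffordAlgebra.involute_ι, neg_mul, ← Algebra.smul_def,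
      sub_eq_add_neg]
  | mul a b ha hb =>
    rw [mul_assoc, ha, hb, ha, map_mul]
    simp only [mul_add, add_mul, mul_assoc, add_assoc]
  | add a b ha hb =>
    rw [add_mul, map_add, ha, hb, map_add, map_add, add_mul, add_mul]
    abel

lemma contractLeft_ι_mul' (v : Module.Dual A M) (a : M) (y : ExteriorAlgebra A M) :
    CliffordAlgebra.contractLeft v (ExteriorAlgebra.ι A a * y) =
      v a • y - ExteriorAlgebra.ι A a * CliffordAlgebra.contractLeft v y :=
  CliffordAlgebra.contractLeft_ι_mul (Q := (0 : QuadraticForm A M)) v a y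

lemma contractLeft_ι' (v : Module.Dual A M) (a : M) :
    CliffordAlgebra.contractLeft v (ExteriorAlgebra.ι A a) =
      algebraMap A (ExteriorAlgebra A M) (v a) :=
  CliffordAlgebra.contractLeft_ι (Q := (0 : QuadraticForm A M)) v a

/-- If the contraction of `ω` by `v` vanishes modulo `J`, then so does the contraction of each
power of `ω`. -/
lemma contractLeft_pow_mem (J : Ideal A) (v : Module.Dual A M) (ω : ExteriorAlgebra A M)
    (h : CliffordAlgebra.contractLeft v ω ∈ J • (⊤ : Submodule A (ExteriorAlgebra A M))) (k : ℕ) :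
    CliffordAlgebra.contractLeft v (ω ^ k) ∈ J • (⊤ : Submodule A (ExteriorAlgebra A M)) := by
  have hmap : ∀ (T : ExteriorAlgebra A M →ₗ[A] ExteriorAlgebra A M),
      ∀ u ∈ J • (⊤ : Submodule A (ExteriorAlgebra A M)), T u ∈ J • (⊤ : Submodule A _) := by
    intro T u hu
    have h2 : T u ∈ (J • (⊤ : Submodule A (ExteriorAlgebra A M))).map T := ⟨u, hu, rfl⟩
    rw [Submodule.map_smul''] at h2
    exact Submodule.smul_mono le_rfl le_top h2
  induction k with
  | zero =>
    rw [pow_zero, ← map_one (algebraMap A _)]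
    have := CliffordAlgebra.contractLeft_algebraMap (Q := (0 : QuadraticForm A M)) v 1
    rw [this]
    exact zero_mem _
  | succ k ih =>
    rw [pow_succ', contractLeft_mul]
    exact add_mem (hmap (LinearMap.mulRight A _) _ h) (hmap (LinearMap.mulLeft A _) _ ih)

/-- The linear map `v ↦ v ⌟ ω` from the dual module to the module attached to a `2`-form. -/
noncomputable def flat (ω : ExteriorAlgebra A M) : Module.Dual A M →ₗ[A] M :=
  ExteriorAlgebra.ιInv ∘ₗ CliffordAlgebra.contractLeft.flip ω

lemma ι_flat {ω : ExteriorAlgebra A M} (hω : ω ∈ ⋀[A]^2 M) (v : Module.Dual A M) :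
    ExteriorAlgebra.ι A (flat ω v) = CliffordAlgebra.contractLeft v ω := by
  have h1 : ω ∈ Submodule.span A (Set.range (ExteriorAlgebra.ιMulti A 2 (M := M))) := by
    rwa [ExteriorAlgebra.ιMulti_span_fixedDegree]
  clear hω
  simp only [flat, LinearMap.comp_apply, LinearMap.flip_apply]
  induction h1 using Submodule.span_induction with
  | mem x hx =>
    obtain ⟨w, rfl⟩ := hx
    have h2 : ExteriorAlgebra.ιMulti A 2 w =
        ExteriorAlgebra.ι A (w 0) * ExteriorAlgebra.ι A (w 1) := by
      simp [ExteriorAlgebra.ιMulti_apply]; rfl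
    have h3 : CliffordAlgebra.contractLeft v (ExteriorAlgebra.ιMulti A 2 w) =
        ExteriorAlgebra.ι A (v (w 0) • w 1 - v (w 1) • w 0) := by
      rw [h2, contractLeft_ι_mul', contractLeft_ι', map_sub, map_smul, map_smul,
        Algebra.smul_def (v (w 1)), Algebra.commutes]
    rw [h3, ExteriorAlgebra.ι_leftInverse]
  | zero => simp
  | add x y _ _ hx hy =>
    rw [map_add, map_add, map_add, hx, hy]
  | smul a x _ hx => rw [map_smul, map_smul, map_smul, hx]

lemma flat_swap {ω : ExteriorAlgebra A M} (hω : ω ∈ ⋀[A]^2 M) (v w : Module.Dual A M) :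
    w (flat ω v) = -v (flat ω w) := by
  have h := CliffordAlgebra.contractLeft_comm (Q := (0 : QuadraticForm A M)) v w ω
  have e : ∀ v w : Module.Dual A M, CliffordAlgebra.contractLeft v
      (CliffordAlgebra.contractLeft (Q := (0 : QuadraticForm A M)) w ω) =
        algebraMap A (ExteriorAlgebra A M) (v (flat ω w)) := by
    intro v w
    rw [← contractLeft_ι', ι_flat hω]
  rw [e, e, ← map_neg] at h
  rw [(ExteriorAlgebra.algebraMap_leftInverse M).injective h, neg_neg]

/-- For a proper submodule `N` of a finite projective module there are a maximal ideal `p` and a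
functional which maps `N` into `p` but is nonzero modulo `p`, by Nakayama's lemma. -/
lemma exists_dual_mem_of_ne_top [Module.Finite A M] [Module.Projective A M] (N : Submodule A M)
    (hN : N ≠ ⊤) : ∃ (p : Ideal A) (_ : p.IsMaximal) (v : Module.Dual A M) (x : M),
      v x ∉ p ∧ ∀ z ∈ N, v z ∈ p := by
  have hann : Module.annihilator A (M ⧸ N) ≠ ⊤ := by
    intro h
    rw [Module.annihilator_eq_top_iff, Submodule.Quotient.subsingleton_iff] at h
    exact hN h
  obtain ⟨p, hp, hle⟩ := Ideal.exists_le_maximal _ hann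
  have hC : p • (⊤ : Submodule A (M ⧸ N)) ≠ ⊤ := by
    intro h
    obtain ⟨r, hr, hr0⟩ := Submodule.exists_sub_one_mem_and_smul_eq_zero_of_fg_of_le_smul p
      (⊤ : Submodule A (M ⧸ N)) Module.Finite.fg_top h.ge
    have h1 : r ∈ p := hle (Module.mem_annihilator.mpr fun z => hr0 z trivial)
    exact hp.ne_top ((Ideal.eq_top_iff_one _).mpr (by simpa using sub_mem h1 hr))
  let := Ideal.Quotient.field p
  let Q := (M ⧸ N) ⧸ p • (⊤ : Submodule A (M ⧸ N))
  obtain ⟨c, hc⟩ : ∃ c : M ⧸ N, c ∉ p • (⊤ : Submodule A (M ⧸ N)) := by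
    by_contra! h
    exact hC (eq_top_iff.mpr fun z _ => h z)
  obtain ⟨x, rfl⟩ := N.mkQ_surjective c
  have hne : (Submodule.mkQ (p • (⊤ : Submodule A (M ⧸ N))) (N.mkQ x) : Q) ≠ 0 := by
    simpa using hc
  obtain ⟨f, hf⟩ : ∃ f : Module.Dual (A ⧸ p) Q,
      f (Submodule.mkQ (p • (⊤ : Submodule A (M ⧸ N))) (N.mkQ x)) ≠ 0 := by
    by_contra! h
    exact hne ((Module.forall_dual_apply_eq_zero_iff (A ⧸ p) _).mp h)
  let g : M →ₗ[A] A ⧸ p := (f.restrictScalars A) ∘ₗ Submodule.mkQ _ ∘ₗ N.mkQ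
  obtain ⟨v, hv⟩ := Module.projective_lifting_property (Submodule.mkQ p) g
    (Submodule.mkQ_surjective p)
  have hv' : ∀ z, v z ∈ p ↔ g z = 0 := fun z => by
    rw [← hv, LinearMap.comp_apply, Submodule.mkQ_apply, Submodule.Quotient.mk_eq_zero]
  refine ⟨p, hp, v, x, fun h => hf ((hv' x).mp h), fun z hz => (hv' z).mpr ?_⟩
  simp only [g, LinearMap.comp_apply, Submodule.mkQ_apply,
    (Submodule.Quotient.mk_eq_zero N).mpr hz]
  simp

/-- In a finite projective module, membership in `J M` can be tested on functionals. -/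
lemma mem_smul_top_of_forall_dual [Module.Finite A M] [Module.Projective A M] (J : Ideal A) (z : M)
    (hz : ∀ w : Module.Dual A M, w z ∈ J) : z ∈ J • (⊤ : Submodule A M) := by
  obtain ⟨m, f, g, -, -, hfg⟩ := Module.Finite.exists_comp_eq_id_of_projective A M
  have e : z = ∑ i, g z i • f (Pi.single i 1) := by
    conv_lhs => rw [← LinearMap.id_apply (R := A) z, ← hfg, LinearMap.comp_apply]
    simp only [← map_smul, ← map_sum]
    congr 1
    ext j
    simp [Finset.sum_apply, Pi.single_apply]
  rw [e]
  exact sum_mem fun i _ =>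
    Submodule.smul_mem_smul (hz ((LinearMap.proj i : (Fin m → A) →ₗ[A] A) ∘ₗ g)) trivial

/-- A `2`-form on a finite projective module without forms of degree `> 2d`, whose `d`-th power
vanishes at no maximal ideal, is nondegenerate. If it were degenerate at `p`, there would be a
functional `v`, nonzero modulo `p`, with `v ⌟ ω = 0` modulo `p`; contracting `x ∧ ωᵈ = 0` with `v`
then gives `v(x) ωᵈ = 0` modulo `p`. -/
lemma flat_surjective [Module.Finite A M] [Module.Projective A M] {ω : ExteriorAlgebra A M}
    (hω : ω ∈ ⋀[A]^2 M) (d : ℕ) (hd : ∀ x : M, ExteriorAlgebra.ι A x * ω ^ d = 0)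
    (hp : ∀ (p : Ideal A) (_ : p.IsMaximal) (r : A), r ∉ p →
      r • ω ^ d ∉ p • (⊤ : Submodule A (ExteriorAlgebra A M))) :
    Function.Surjective (flat ω) := by
  rw [← LinearMap.range_eq_top]
  by_contra hN
  obtain ⟨p, hpm, v, x, hx, hv⟩ := exists_dual_mem_of_ne_top _ hN
  refine hp p hpm (v x) hx ?_
  have h1 : flat ω v ∈ p • (⊤ : Submodule A M) := mem_smul_top_of_forall_dual p _ fun w => by
    rw [flat_swap hω]
    exact neg_mem (hv _ ⟨w, rfl⟩)
  have h2 : CliffordAlgebra.contractLeft v ω ∈ p • (⊤ : Submodule A (ExteriorAlgebra A M)) := by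
    rw [← ι_flat hω]
    have h3 : ExteriorAlgebra.ι A (flat ω v) ∈
        (p • (⊤ : Submodule A M)).map (ExteriorAlgebra.ι A) := ⟨_, h1, rfl⟩
    rw [Submodule.map_smul''] at h3
    exact Submodule.smul_mono le_rfl le_top h3
  have h4 := contractLeft_pow_mem p v ω h2 d
  have h5 := contractLeft_ι_mul' v x (ω ^ d)
  rw [hd, map_zero, eq_comm, sub_eq_zero] at h5
  rw [h5]
  have h6 : ExteriorAlgebra.ι A x * CliffordAlgebra.contractLeft v (ω ^ d) ∈
      (p • (⊤ : Submodule A (ExteriorAlgebra A M))).map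
        (LinearMap.mulLeft A (ExteriorAlgebra.ι A x)) := ⟨_, h4, rfl⟩
  rw [Submodule.map_smul''] at h6
  exact Submodule.smul_mono le_rfl le_top h6

end Nondegenerate

end PoissonDeRham

namespace PoissonDeRham

open KaehlerDifferential

/-! ### Contraction and evaluation of exterior forms -/

section Contraction

variable {A M : Type*} [CommRing A] [AddCommGroup M] [Module A M]

lemma contractLeft_ιMulti (f : Module.Dual A M) {n : ℕ} (w : Fin (n + 1) → M) :
    CliffordAlgebra.contractLeft f (ExteriorAlgebra.ιMulti A (n + 1) w) =
      ∑ i : Fin (n + 1), ((-1) ^ (i : ℕ) * f (w i)) •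
        ExteriorAlgebra.ιMulti A n (i.removeNth w) := by
  induction n with
  | zero =>
    rw [ExteriorAlgebra.ιMulti_succ_apply, contractLeft_ι_mul', ExteriorAlgebra.ιMulti_zero_apply]
    have := CliffordAlgebra.contractLeft_one (Q := (0 : QuadraticForm A M)) f
    rw [this]
    simp
  | succ n ih =>
    rw [ExteriorAlgebra.ιMulti_succ_apply, contractLeft_ι_mul', ih,
      Fin.sum_univ_succ (n := n + 1), Finset.mul_sum, sub_eq_add_neg, ← Finset.sum_neg_distrib]
    refine congrArg₂ (· + ·) (by simp [Fin.removeNth_zero]; rfl)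
      (Finset.sum_congr rfl fun i _ => ?_)
    have e : i.succ.removeNth w = Fin.cons (w 0) (i.removeNth (Matrix.vecTail w)) := by
      funext j
      refine Fin.cases ?_ (fun j => ?_) j <;>
        simp [Fin.removeNth, Fin.succ_succAbove_succ, Matrix.vecTail]
    rw [e, ExteriorAlgebra.ιMulti_succ_apply, mul_smul_comm, Fin.val_succ, pow_succ, ← neg_smul]
    congr 1
    simp [Matrix.vecTail]

/-- Contraction `⋀ⁿ⁺¹ M → ⋀ⁿ M` with a functional. -/
noncomputable def contractPow (f : Module.Dual A M) (n : ℕ) : (⋀[A]^(n + 1) M) →ₗ[A] ⋀[A]^n M :=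
  (CliffordAlgebra.contractLeft f).restrict (p := ⋀[A]^(n + 1) M) (q := ⋀[A]^n M) (by
    intro η hη
    rw [← ExteriorAlgebra.ιMulti_span_fixedDegree] at hη
    induction hη using Submodule.span_induction with
    | mem x hx =>
      obtain ⟨w, rfl⟩ := hx
      rw [contractLeft_ιMulti]
      exact sum_mem fun i _ => Submodule.smul_mem _ _
        (ExteriorAlgebra.ιMulti_range A n (Set.mem_range_self _))
    | zero => rw [map_zero]; exact zero_mem _
    | add x y _ _ hx hy => rw [map_add]; exact add_mem hx hy
    | smul a x _ hx => rw [map_smul]; exact Submodule.smul_mem _ _ hx)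

lemma coe_contractPow (f : Module.Dual A M) {n : ℕ} (η : ⋀[A]^(n + 1) M) :
    (contractPow f n η : ExteriorAlgebra A M) = CliffordAlgebra.contractLeft f η.1 := rfl

/-- Evaluation on `f₀ ∧ f₁ ∧ … ∧ fₙ` is contraction with `f₀` followed by evaluation
on `f₁ ∧ … ∧ fₙ`: the Laplace expansion of the determinant. -/
lemma pairingDual_cons {n : ℕ} (f : Module.Dual A M) (g : Fin n → Module.Dual A M)
    (η : ⋀[A]^(n + 1) M) :
    exteriorPower.pairingDual A M (n + 1)
        (exteriorPower.ιMulti A (n + 1) (Fin.cons f g : Fin (n + 1) → Module.Dual A M)) η =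
      exteriorPower.pairingDual A M n (exteriorPower.ιMulti A n g) (contractPow f n η) := by
  have : exteriorPower.pairingDual A M (n + 1)
        (exteriorPower.ιMulti A (n + 1) (Fin.cons f g : Fin (n + 1) → Module.Dual A M)) =
      exteriorPower.pairingDual A M n (exteriorPower.ιMulti A n g) ∘ₗ contractPow f n := by
    apply exteriorPower.linearMap_ext
    ext1 w
    have e : contractPow f n (exteriorPower.ιMulti A (n + 1) w) =
        ∑ i : Fin (n + 1), ((-1) ^ (i : ℕ) * f (w i)) •
          exteriorPower.ιMulti A n (i.removeNth w) := by
      apply Subtype.ext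
      rw [coe_contractPow, exteriorPower.ιMulti_apply_coe, contractLeft_ιMulti]
      simp
    simp only [LinearMap.compAlternatingMap_apply, LinearMap.comp_apply, e, map_sum, map_smul,
      exteriorPower.pairingDual_ιMulti_ιMulti]
    rw [Matrix.det_succ_column_zero]
    rfl
  rw [this, LinearMap.comp_apply]

end Contraction

section Forms

variable {S A : Type} [CommRing S] [CommRing A] [Algebra S A]

/-- The exterior algebra of the differentials is generated by functions and exact `1`-forms. -/
lemma formAlg_induction {p : FormAlg S A → Prop} (fn : ∀ a, p (algebraMap A _ a))
    (exact : ∀ a, p (dd S A a)) (mul : ∀ x y, p x → p y → p (x * y))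
    (add : ∀ x y, p x → p y → p (x + y)) (x : FormAlg S A) : p x := by
  induction x using ExteriorAlgebra.induction with
  | algebraMap r => exact fn r
  | mul x y hx hy => exact mul x y hx hy
  | add x y hx hy => exact add x y hx hy
  | ι x =>
    have hm : x ∈ Submodule.span A (Set.range (D S A)) := by
      rw [span_range_derivation]; trivial
    induction hm using Submodule.span_induction with
    | zero => simpa using fn 0
    | add x y _ _ hx hy => rw [map_add]; exact add _ _ hx hy
    | smul a x _ hx => rw [map_smul, Algebra.smul_def]; exact mul _ _ (fn a) hx
    | mem x hx =>
      obtain ⟨b, rfl⟩ := hx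
      exact exact b

lemma contract_mul (v : Derivation S A A) (x y : FormAlg S A) :
    contract v (x * y) = contract v x * y + sgn S A x * contract v y :=
  contractLeft_mul _ x y

lemma contract_add (v : Derivation S A A) (x y : FormAlg S A) :
    contract v (x + y) = contract v x + contract v y := map_add _ x y

lemma contract_algebraMap (v : Derivation S A A) (a : A) :
    contract v (algebraMap A (FormAlg S A) a) = 0 :=
  CliffordAlgebra.contractLeft_algebraMap (Q := (0 : QuadraticForm A Ω[A⁄S])) _ a

lemma contract_dd (v : Derivation S A A) (a : A) :
    contract v (dd S A a) = algebraMap A _ (v a) := by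
  have := contractLeft_ι' v.liftKaehlerDifferential (D S A a)
  rwa [Derivation.liftKaehlerDifferential_comp_D] at this

lemma sgn_sgn (x : FormAlg S A) : sgn S A (sgn S A x) = x := CliffordAlgebra.involute_involute x

lemma sgn_contract (v : Derivation S A A) (x : FormAlg S A) :
    sgn S A (contract v x) = -contract v (sgn S A x) := by
  induction x using formAlg_induction with
  | fn a => simp [contract_algebraMap, AlgHom.commutes]
  | exact a =>
    rw [sgn_dd, contract_dd, AlgHom.commutes, ← contract_dd v a]
    exact (neg_eq_iff_eq_neg.mpr (map_neg _ _)).symm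
  | mul x y hx hy =>
    rw [contract_mul, map_add, map_mul, map_mul, hx, hy, map_mul, contract_mul]
    noncomm_ring
  | add x y hx hy => rw [contract_add, map_add, hx, hy, map_add, contract_add, neg_add]

lemma sgn_extD (x : FormAlg S A) : sgn S A (extD S A x) = -extD S A (sgn S A x) := by
  induction x using formAlg_induction with
  | fn a => rw [extD_algebraMap, sgn_dd, AlgHom.commutes, extD_algebraMap]
  | exact a => rw [extD_dd, sgn_dd, map_neg, extD_dd]; simp
  | mul x y hx hy =>
    rw [extD_mul, map_add, map_mul, map_mul, hx, hy, map_mul, extD_mul]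
    noncomm_ring
  | add x y hx hy => rw [map_add, map_add, hx, hy, map_add, map_add, neg_add]

/-- The Lie derivative of forms along a vector field, by Cartan's formula. -/
noncomputable def lieForm (v : Derivation S A A) (x : FormAlg S A) : FormAlg S A :=
  extD S A (contract v x) + contract v (extD S A x)

lemma lieForm_add (v : Derivation S A A) (x y : FormAlg S A) :
    lieForm v (x + y) = lieForm v x + lieForm v y := by
  simp only [lieForm, contract_add, map_add]
  abel

lemma lieForm_mul (v : Derivation S A A) (x y : FormAlg S A) :
    lieForm v (x * y) = lieForm v x * y + x * lieForm v y := by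
  simp only [lieForm, contract_mul, extD_mul, map_add, contract_add, sgn_contract, sgn_extD,
    sgn_sgn]
  noncomm_ring

lemma lieForm_algebraMap (v : Derivation S A A) (a : A) :
    lieForm v (algebraMap A (FormAlg S A) a) = algebraMap A _ (v a) := by
  rw [lieForm, contract_algebraMap, map_zero, zero_add, extD_algebraMap, contract_dd]

lemma lieForm_dd (v : Derivation S A A) (a : A) : lieForm v (dd S A a) = dd S A (v a) := by
  rw [lieForm, contract_dd, extD_algebraMap, extD_dd]
  exact (congrArg _ (map_zero (CliffordAlgebra.contractLeft _))).trans (add_zero _)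

lemma sgn_lieForm (v : Derivation S A A) (x : FormAlg S A) :
    sgn S A (lieForm v x) = lieForm v (sgn S A x) := by
  simp only [lieForm, map_add, sgn_extD, sgn_contract]
  have e : ∀ z, contract v (-z) = -contract v z := fun z => map_neg _ z
  simp only [map_neg, e, neg_neg]

/-- The commutator of a Lie derivative with a contraction is the contraction with the Lie
bracket. -/
lemma lieForm_contract (u v : Derivation S A A) (x : FormAlg S A) :
    lieForm u (contract v x) = contract v (lieForm u x) + contract ⁅u, v⁆ x := by
  induction x using formAlg_induction with
  | fn a =>
    simp only [contract_algebraMap, lieForm_algebraMap, add_zero]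
    simpa using lieForm_algebraMap u (0 : A)
  | exact a =>
    rw [contract_dd, lieForm_algebraMap, lieForm_dd, contract_dd, contract_dd, ← map_add,
      Derivation.commutator_apply]
    congr 1
    ring
  | mul x y hx hy =>
    simp only [contract_mul, lieForm_add, lieForm_mul, hx, hy, contract_add, ← sgn_lieForm]
    noncomm_ring
  | add x y hx hy =>
    simp only [contract_add, lieForm_add, hx, hy]
    abel

end Forms

end PoissonDeRham

namespace PoissonDeRham

open KaehlerDifferential

/-! ### From forms to polyvector fields -/

namespace PoissonBracket

variable {S A : Type} [CommRing S] [CommRing A] [Algebra S A] (P : PoissonBracket S A)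

/-- The linear map `Ω → Ω*`, `da ↦ H_a`, given by the Poisson bivector. -/
noncomputable def sharp : Ω[A⁄S] →ₗ[A] Module.Dual A Ω[A⁄S] :=
  Derivation.liftKaehlerDifferential (M := Module.Dual A Ω[A⁄S])
    { toFun := fun a => (P.ham a).liftKaehlerDifferential
      map_add' := fun a b => by
        apply Derivation.liftKaehlerDifferential_unique
        ext c
        simp [Derivation.liftKaehlerDifferential_comp_D, ham]
      map_smul' := fun s a => by
        apply Derivation.liftKaehlerDifferential_unique
        ext c
        simp [Derivation.liftKaehlerDifferential_comp_D, ham]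
      map_one_eq_zero' := by
        apply Derivation.liftKaehlerDifferential_unique
        ext c
        have h : P.br c 1 = 0 := (P.ham c).map_one_eq_zero
        simp [Derivation.liftKaehlerDifferential_comp_D, ham, P.swap 1 c, h]
      leibniz' := fun a b => by
        apply Derivation.liftKaehlerDifferential_unique
        ext c
        simp [Derivation.liftKaehlerDifferential_comp_D, ham, P.leibniz'] }

lemma sharp_D (a : A) : P.sharp (D S A a) = (P.ham a).liftKaehlerDifferential :=
  Derivation.liftKaehlerDifferential_comp_D _ a

@[simp] lemma sharp_D_D (a b : A) : P.sharp (D S A a) (D S A b) = P.br a b := by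
  rw [sharp_D, Derivation.liftKaehlerDifferential_comp_D]
  rfl

lemma ham_apply (a b : A) : P.ham a b = P.br a b := rfl

lemma sharp_swap (x y : Ω[A⁄S]) : P.sharp x y = -P.sharp y x := by
  have : P.sharp = -P.sharp.flip := by
    apply Derivation.liftKaehlerDifferential_unique
    ext1 a
    apply Derivation.liftKaehlerDifferential_unique
    ext1 b
    simpa using P.swap a b
  exact congrArg (fun F => F x y) this

lemma lie_ham (a b : A) : ⁅P.ham a, P.ham b⁆ = P.ham (P.br a b) := by
  ext c
  simp only [Derivation.commutator_apply, ham_apply, P.jacobi']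

/-- The map `⋀ⁿ Ω → ⋀ⁿ Θ`, `η ↦ ((a₁, …, aₙ) ↦ η(H_{a₁}, …, H_{aₙ}))`. -/
noncomputable def toPolyvector (n : ℕ) : Form S A n →ₗ[A] Polyvector S A n := raise P.sharp n

lemma toAlt_toPolyvector {n : ℕ} (η : Form S A n) (a : Fin n → A) :
    (P.toPolyvector n η).toAlt a = η.eval fun i => P.ham (a i) := by
  rw [Polyvector.toAlt_apply, toPolyvector, raise_ιMulti]
  simp only [sharp_D]
  rfl

lemma toPolyvector_ιMulti {n : ℕ} (w : Fin n → Ω[A⁄S]) (a : Fin n → A) :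
    (P.toPolyvector n (exteriorPower.ιMulti A n w)).toAlt a =
      (Matrix.of fun i j => P.sharp (D S A (a j)) (w i)).det := by
  rw [Polyvector.toAlt_apply, toPolyvector, raise_ιMulti_ιMulti]

/-- Contraction of forms with `H_a`. -/
noncomputable def contractHam (a : A) (n : ℕ) : Form S A (n + 1) →ₗ[A] Form S A n :=
  contractPow (P.ham a).liftKaehlerDifferential n

lemma curryLeft_toPolyvector (a : A) {n : ℕ} (η : Form S A (n + 1)) :
    (P.toPolyvector (n + 1) η).toAlt.curryLeft a =
      (P.toPolyvector n (P.contractHam a n η)).toAlt := by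
  ext v
  rw [AlternatingMap.curryLeft_apply_apply, toAlt_toPolyvector, toAlt_toPolyvector, Form.eval,
    Form.eval, Polyvector.wedge, Polyvector.wedge, contractHam, ← pairingDual_cons]
  congr 3
  funext i
  refine Fin.cases ?_ (fun i => ?_) i <;> rfl

lemma contract_zero_form (v : Derivation S A A) (η : Form S A 0) :
    contract v (η : FormAlg S A) = 0 := by
  induction η using form_induction with
  | gen a b =>
    have e : ((a • exteriorPower.ιMulti A 0 fun i => D S A (b i) : Form S A 0) : FormAlg S A) =
        algebraMap A _ a := by
      simp [Algebra.algebraMap_eq_smul_one]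
    rw [e, contract_algebraMap]
  | add x y hx hy => rw [Submodule.coe_add, contract_add, hx, hy, add_zero]

lemma lieForm_mem (v : Derivation S A A) {n : ℕ} (η : Form S A n) :
    lieForm v (η : FormAlg S A) ∈ ⋀[A]^n Ω[A⁄S] := by
  refine add_mem ?_ (contractPow v.liftKaehlerDifferential n (formD S A n η)).2
  cases n with
  | zero => rw [contract_zero_form, map_zero]; exact zero_mem _
  | succ n => exact (formD S A n (contractPow v.liftKaehlerDifferential n η)).2

/-- The Lie derivative of an `n`-form along `H_a`. -/
noncomputable def lieHam (a : A) (n : ℕ) (η : Form S A n) : Form S A n :=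
  ⟨lieForm (P.ham a) η, lieForm_mem _ η⟩

lemma toAlt_sub {n : ℕ} (f g : Polyvector S A n) : (f - g).toAlt = f.toAlt - g.toAlt := rfl

/-- The Lie derivatives along `H_a` of forms and of alternating cochains correspond. -/
lemma lie_toPolyvector (a : A) {n : ℕ} (η : Form S A n) :
    P.lie a (P.toPolyvector n η).toAlt = (P.toPolyvector n (P.lieHam a n η)).toAlt := by
  induction n generalizing a with
  | zero =>
    have hadd : ∀ x y : Form S A 0, P.lieHam a 0 (x + y) = P.lieHam a 0 x + P.lieHam a 0 y :=
      fun x y => Subtype.ext (lieForm_add _ _ _)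
    induction η using form_induction with
    | gen r b =>
      have e : ∀ r : A, ((r • exteriorPower.ιMulti A 0 fun i => D S A (b i) : Form S A 0) :
          FormAlg S A) = algebraMap A _ r := by
        intro r
        simp [Algebra.algebraMap_eq_smul_one]
      have e2 : P.lieHam a 0 (r • exteriorPower.ιMulti A 0 fun i => D S A (b i)) =
          P.br a r • exteriorPower.ιMulti A 0 fun i => D S A (b i) := by
        apply Subtype.ext
        rw [e]
        exact (congrArg (lieForm (P.ham a)) (e r)).trans (lieForm_algebraMap _ _)
      rw [e2]
      ext v
      simp only [lie_apply, lieFun, Finset.univ_eq_empty, Finset.sum_empty, sub_zero, map_smul]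
      have e3 : ∀ (c : A) (f : Polyvector S A 0), (c • f).toAlt v = c * f.toAlt v :=
        fun _ _ => rfl
      rw [e3, e3, toPolyvector_ιMulti]
      simp
    | add x y hx hy =>
      have e : ∀ f g : Polyvector S A 0, (f + g).toAlt = f.toAlt + g.toAlt := fun _ _ => rfl
      have e2 : ∀ f g : A [⋀^Fin 0]→ₗ[S] A, P.lie a (f + g) = P.lie a f + P.lie a g :=
        fun f g => AlternatingMap.ext fun v => P.lieFun_add a f g v
      rw [map_add, e, e2, hx, hy, hadd, map_add, e]
  | succ n ih =>
    refine curry_ext fun c => ?_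
    rw [curry_lie, curryLeft_toPolyvector, curryLeft_toPolyvector, curryLeft_toPolyvector, ih,
      ← toAlt_sub, ← map_sub]
    congr 2
    apply Subtype.ext
    have := lieForm_contract (P.ham a) (P.ham c) (η : FormAlg S A)
    rw [lie_ham] at this
    exact sub_eq_iff_eq_add.mpr this

/-- The map from forms to polyvector fields is a morphism of complexes: the inductive description
of `δ` through Lie derivatives corresponds to Cartan's formula for `d`. -/
lemma delta_toPolyvector {n : ℕ} (η : Form S A n) :
    P.delta n (P.toPolyvector n η) = P.toPolyvector (n + 1) (formD S A n η) := by
  apply Polyvector.toAlt_injective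
  rw [toAlt_delta]
  induction n with
  | zero =>
    refine curry_ext fun c => ?_
    rw [curry_lpAlt_zero, lie_toPolyvector, curryLeft_toPolyvector]
    congr 2
    apply Subtype.ext
    change extD S A (contract (P.ham c) (η : FormAlg S A)) + _ = _
    rw [contract_zero_form, map_zero, zero_add]
    rfl
  | succ n ih =>
    refine curry_ext fun c => ?_
    rw [curry_lpAlt, lie_toPolyvector, curryLeft_toPolyvector, curryLeft_toPolyvector, ih,
      ← toAlt_sub, ← map_sub]
    congr 2
    apply Subtype.ext
    exact sub_eq_iff_eq_add'.mpr rfl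

/-- The Poisson bracket as an alternating map. -/
def brAlt : A [⋀^Fin 2]→ₗ[S] A where
  toFun v := P.br (v 0) (v 1)
  map_update_add' := by
    intro inst w i x y
    obtain rfl := Subsingleton.elim inst (instDecidableEqFin 2)
    fin_cases i <;> simp
  map_update_smul' := by
    intro inst w i c x
    obtain rfl := Subsingleton.elim inst (instDecidableEqFin 2)
    fin_cases i <;> simp
  map_eq_zero_of_eq' := by
    intro w i j hij hne
    fin_cases i <;> fin_cases j <;> simp_all [P.self]

lemma brAlt_apply (v : Fin 2 → A) : P.brAlt v = P.br (v 0) (v 1) := rfl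

lemma isMultiDer_brAlt : IsMultiDer P.brAlt := by
  intro v i x y
  simp only [brAlt_apply]
  fin_cases i
  · simp [P.leibniz']
  · simp [P.leibniz, mul_comm, add_comm]

/-- The Poisson bivector. -/
noncomputable def bivector : Polyvector S A 2 := Polyvector.ofAlt P.brAlt P.isMultiDer_brAlt

lemma toAlt_bivector (v : Fin 2 → A) : P.bivector.toAlt v = P.br (v 0) (v 1) := by
  rw [bivector, Polyvector.toAlt_ofAlt, brAlt_apply]

/-- The bivector is a cocycle: this is the Jacobi identity. -/
lemma delta_bivector : P.delta 2 P.bivector = 0 := by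
  apply Polyvector.ext'
  intro v
  rw [toAlt_delta, lpAlt_apply, bivector, Polyvector.toAlt_ofAlt]
  have h0 := P.jacobi' (v 0) (v 1) (v 2)
  have h1 := P.jacobi' (v 0) (v 2) (v 1)
  have h3 := P.swap (v 2) (v 1)
  have h4 := P.swap (v 2) (P.br (v 0) (v 1))
  have e : (0 : Polyvector S A 3).toAlt v = 0 := rfl
  rw [e]
  simp [lpFun, Fin.sum_univ_three, brAlt_apply, Fin.removeNth, Fin.succAbove]
  rw [h1, h4, h0, h3, map_neg]
  ring

/-- The Poisson bracket is nondegenerate: the map `Ω → Ω*` given by the bivector admits a frame. -/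
def Nondegenerate : Prop := ∃ (m : ℕ) (x y : Fin m → Ω[A⁄S]), IsFrame P.sharp x y

variable {P}

namespace Nondegenerate

variable (hP : P.Nondegenerate)
include hP

lemma sharp_injective : Function.Injective P.sharp := by
  obtain ⟨m, x, y, h⟩ := hP
  exact h.injective P.sharp_swap

lemma sharp_surjective : Function.Surjective P.sharp := by
  obtain ⟨m, x, y, h⟩ := hP
  exact h.surjective

variable (hA : ∀ n : ℕ, IsUnit (n.factorial : A))
include hA

lemma bijective_toPolyvector (n : ℕ) : Function.Bijective (P.toPolyvector n) := by
  obtain ⟨m, x, y, h⟩ := hP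
  exact h.bijective_raise P.sharp_swap (hA n)

/-- The isomorphism from forms to polyvector fields of a nondegenerate Poisson bracket. -/
noncomputable def equiv (n : ℕ) : Form S A n ≃ₗ[A] Polyvector S A n :=
  LinearEquiv.ofBijective (P.toPolyvector n) (hP.bijective_toPolyvector hA n)

lemma toPolyvector_equiv_symm {n : ℕ} (f : Polyvector S A n) :
    P.toPolyvector n ((hP.equiv hA n).symm f) = f :=
  (hP.equiv hA n).apply_symm_apply f

/-- The symplectic form of a nondegenerate Poisson bracket. -/
noncomputable def form : Form S A 2 := (hP.equiv hA 2).symm P.bivector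

lemma toPolyvector_form : P.toPolyvector 2 (hP.form hA) = P.bivector :=
  hP.toPolyvector_equiv_symm hA _

lemma eval_form (a b : A) : (hP.form hA).eval ![P.ham a, P.ham b] = P.br a b := by
  have h := P.toAlt_toPolyvector (hP.form hA) ![a, b]
  rw [toPolyvector_form, toAlt_bivector] at h
  rw [show ![P.ham a, P.ham b] = fun i => P.ham (![a, b] i) by
    funext i; fin_cases i <;> rfl, ← h]
  rfl

lemma formD_form : formD S A 2 (hP.form hA) = 0 := by
  apply (hP.bijective_toPolyvector hA 3).injective
  rw [← delta_toPolyvector, toPolyvector_form, delta_bivector, map_zero]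

end Nondegenerate
end PoissonBracket

section Functoriality

variable {S A B : Type} [CommRing S] [CommRing A] [CommRing B] [Algebra S A] [Algebra S B]

/-- Polyvector fields on `B` are determined by their values on functions coming from `A`, if the
differentials of these generate `Ω_B`. -/
lemma Polyvector.Compatible.unique {φ : A →ₐ[S] B}
    (hφ : Submodule.span B (Set.range fun a => D S B (φ a)) = ⊤) {n : ℕ} {f : Polyvector S A n}
    {g g' : Polyvector S B n} (h : Polyvector.Compatible φ f g)
    (h' : Polyvector.Compatible φ f g') : g = g' := by
  rw [Polyvector.compatible_iff] at h h'
  apply LinearMap.ext_on (exteriorPower.ιMulti_span_of_span B n _ hφ)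
  rintro _ ⟨w, hw, rfl⟩
  choose a ha using fun i => hw (Set.mem_range_self i)
  obtain rfl : (fun i => D S B (φ (a i))) = w := funext ha
  exact (h a).trans (h' a).symm

lemma compatible_toPolyvector (φ : A →ₐ[S] B) (P : PoissonBracket S A) (Q : PoissonBracket S B)
    (h : ∀ a b, Q.br (φ a) (φ b) = φ (P.br a b)) {n : ℕ} (η : Form S A n) :
    Polyvector.Compatible φ (P.toPolyvector n η) (Q.toPolyvector n (formMap φ n η)) := by
  rw [Polyvector.compatible_iff]
  intro a
  induction η using form_induction with
  | gen r b =>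
    have e : ∀ (c : A) (f : Polyvector S A n), (c • f).toAlt a = c * f.toAlt a :=
      fun _ _ => rfl
    have e' : ∀ (c : B) (f : Polyvector S B n) v, (c • f).toAlt v = c * f.toAlt v :=
      fun _ _ _ => rfl
    rw [formMap_gen, map_smul, map_smul, e, e', PoissonBracket.toPolyvector_ιMulti,
      PoissonBracket.toPolyvector_ιMulti, map_mul, AlgHom.map_det]
    congr 2
    ext i j
    simp [h]
  | add x y hx hy =>
    have e : ∀ (f g : Polyvector S A n), (f + g).toAlt a = f.toAlt a + g.toAlt a :=
      fun _ _ => rfl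
    have e' : ∀ (f g : Polyvector S B n) v, (f + g).toAlt v = f.toAlt v + g.toAlt v :=
      fun _ _ _ => rfl
    rw [map_add, map_add, map_add, e, e', hx, hy, map_add]

/-- Forms corresponding to compatible polyvector fields are compatible. -/
lemma formMap_eq_of_compatible {φ : A →ₐ[S] B}
    (hφ : Submodule.span B (Set.range fun a => D S B (φ a)) = ⊤)
    {P : PoissonBracket S A} {Q : PoissonBracket S B}
    (h : ∀ a b, Q.br (φ a) (φ b) = φ (P.br a b)) {n : ℕ}
    (hQ : Function.Injective (Q.toPolyvector n)) {η : Form S A n} {η' : Form S B n}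
    (hη : Polyvector.Compatible φ (P.toPolyvector n η) (Q.toPolyvector n η')) :
    formMap φ n η = η' :=
  hQ ((compatible_toPolyvector φ P Q h η).unique hφ hη)

end Functoriality

section Contraction

variable {S A : Type} [CommRing S] [CommRing A] [Algebra S A]

/-- The value of a `2`-form on two vector fields is an iterated contraction. -/
lemma eval_two (ω : Form S A 2) (v w : Derivation S A A) :
    ω.eval ![v, w] = w.liftKaehlerDifferential
      (flat (ω : FormAlg S A) v.liftKaehlerDifferential) := by
  have e : contractPow v.liftKaehlerDifferential 1 ω =
      exteriorPower.ιMulti A 1 fun _ => flat (ω : FormAlg S A) v.liftKaehlerDifferential := by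
    apply Subtype.ext
    rw [coe_contractPow, ← ι_flat ω.2]
    simp
  have e2 : (fun i => (![v, w] i).liftKaehlerDifferential) =
      (Fin.cons v.liftKaehlerDifferential fun _ => w.liftKaehlerDifferential :
        Fin 2 → Module.Dual A Ω[A⁄S]) := by
    funext i
    fin_cases i <;> rfl
  rw [Form.eval, Polyvector.wedge, e2, pairingDual_cons, e,
    exteriorPower.pairingDual_ιMulti_ιMulti]
  simp

lemma contract_eq_ι_flat (ω : Form S A 2) (v : Derivation S A A) :
    contract v (ω : FormAlg S A) =
      ExteriorAlgebra.ι A (flat (ω : FormAlg S A) v.liftKaehlerDifferential) :=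
  (ι_flat ω.2 _).symm

namespace PoissonBracket.Nondegenerate

variable {P : PoissonBracket S A} (hP : P.Nondegenerate)
  (hA : ∀ n : ℕ, IsUnit (n.factorial : A))
include hP hA

/-- The symplectic form is inverse to the bivector, up to the sign inherent in the convention
`ω(H_a, H_b) = {a, b}`. -/
lemma flat_form_sharp (z : Ω[A⁄S]) : flat (hP.form hA : FormAlg S A) (P.sharp z) = -z := by
  have : flat (hP.form hA : FormAlg S A) ∘ₗ P.sharp = -LinearMap.id := by
    apply Derivation.liftKaehlerDifferential_unique
    ext1 a
    apply hP.sharp_injective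
    apply Derivation.liftKaehlerDifferential_unique
    ext1 b
    have h := hP.eval_form hA a b
    rw [eval_two, ← sharp_D, ← sharp_D] at h
    change P.sharp (flat _ (P.sharp (D S A a))) (D S A b) = P.sharp (-D S A a) (D S A b)
    rw [sharp_swap, h, map_neg, LinearMap.neg_apply, sharp_D_D]
  exact congrArg (fun F => F z) this

/-- The isomorphism sends `v₁ ∧ … ∧ vₙ` to `(v₁ ⌟ ω) ∧ … ∧ (vₙ ⌟ ω)`. -/
lemma equiv_symm_wedge {n : ℕ} (v : Fin n → Derivation S A A) :
    ((hP.equiv hA n).symm (Polyvector.wedge v) : FormAlg S A) =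
      (List.ofFn fun k => contract (v k) (hP.form hA : FormAlg S A)).prod := by
  choose z hz using fun k => hP.sharp_surjective (v k).liftKaehlerDifferential
  have e : (hP.equiv hA n).symm (Polyvector.wedge v) = exteriorPower.ιMulti A n fun k => -z k := by
    rw [LinearEquiv.symm_apply_eq]
    apply Polyvector.ext'
    intro a
    refine Eq.trans ?_ (P.toPolyvector_ιMulti (fun k => -z k) a).symm
    rw [Polyvector.toAlt_apply, Polyvector.wedge, exteriorPower.pairingDual_ιMulti_ιMulti,
      ← Matrix.det_transpose]
    congr 1
    ext i j
    simp [← hz, P.sharp_swap (z i)]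
  rw [e, exteriorPower.ιMulti_apply_coe, ExteriorAlgebra.ιMulti_apply]
  congr 2
  funext k
  rw [contract_eq_ι_flat, ← hz, flat_form_sharp]

end PoissonBracket.Nondegenerate
end Contraction

end PoissonDeRham

namespace PoissonDeRham

open KaehlerDifferential TensorProduct

/-! ### Nondegeneracy lifts along nilpotent thickenings -/

section Lifting

variable {S k A A₀ : Type} [CommRing S] [CommRing k] [CommRing A] [CommRing A₀]
  [Algebra S A] [Algebra k A₀]

section Tower

variable [Algebra S k] [Algebra A A₀] [Algebra S A₀] [IsScalarTower S k A₀] [IsScalarTower S A A₀]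

variable (S) in
/-- If `A → A₀` is surjective with kernel generated by `I ⊆ S`, the kernel of `Ω_{A/S} → Ω_{A₀/S}`
is contained in `I Ω_{A/S}`. -/
lemma mem_smul_top_of_map_eq_zero (hs : Function.Surjective (algebraMap A A₀)) (I : Ideal S)
    (hI : ∀ s ∈ I, algebraMap S A₀ s = 0)
    (hker : RingHom.ker (algebraMap A A₀) ≤ I.map (algebraMap S A)) (z : Ω[A⁄S])
    (hz : KaehlerDifferential.map S S A A₀ z = 0) :
    z ∈ I.map (algebraMap S A) • (⊤ : Submodule A Ω[A⁄S]) := by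
  have h0 : (1 : A₀) ⊗ₜ[A] z = 0 := by
    have h1 : KaehlerDifferential.mapBaseChange S A A₀ ((1 : A₀) ⊗ₜ z) = 0 := by simpa using hz
    obtain ⟨c, hc⟩ := (exact_kerCotangentToTensor_mapBaseChange S A A₀ hs _).mp h1
    obtain ⟨j, rfl⟩ := Ideal.toCotangent_surjective _ c
    rw [← hc]
    obtain ⟨j, hj'⟩ := j
    change (1 : A₀) ⊗ₜ[A] D S A j = 0
    have hj := hker hj'
    clear hj' hc
    induction hj using Submodule.span_induction with
    | mem x hx =>
      obtain ⟨s, hs, rfl⟩ := hx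
      simp
    | zero => simp
    | add x y _ _ hx hy => rw [map_add, tmul_add, hx, hy, add_zero]
    | smul a x hx' hx =>
      have hx0 : algebraMap A A₀ x = 0 := by
        have : I.map (algebraMap S A) ≤ RingHom.ker (algebraMap A A₀) := by
          rw [Ideal.map_le_iff_le_comap]
          intro s hs
          rw [Ideal.mem_comap, RingHom.mem_ker, ← IsScalarTower.algebraMap_apply, hI s hs]
        exact this hx'
      rw [smul_eq_mul, Derivation.leibniz, tmul_add, tmul_smul, hx, smul_zero, zero_add,
        ← smul_tmul, Algebra.smul_def, hx0, zero_mul, zero_tmul]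
  let e := (TensorProduct.congr
    (Ideal.quotientKerAlgEquivOfSurjective (f := Algebra.ofId A A₀) hs).symm.toLinearEquiv
    (LinearEquiv.refl A Ω[A⁄S])) ≪≫ₗ
      TensorProduct.quotTensorEquivQuotSMul Ω[A⁄S] (RingHom.ker (Algebra.ofId A A₀))
  have h2 : e (1 ⊗ₜ z) = 0 := by rw [h0, map_zero]
  have h3 : e (1 ⊗ₜ z) = Submodule.Quotient.mk z := by
    simp only [e, LinearEquiv.trans_apply, TensorProduct.congr_tmul, LinearEquiv.refl_apply]
    have : (Ideal.quotientKerAlgEquivOfSurjective (f := Algebra.ofId A A₀) hs).symm.toLinearEquiv 1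
        = Ideal.Quotient.mk _ 1 := map_one
          (Ideal.quotientKerAlgEquivOfSurjective (f := Algebra.ofId A A₀) hs).symm
    rw [this]
    simp
  rw [h3, Submodule.Quotient.mk_eq_zero] at h2
  exact Submodule.smul_mono hker le_rfl h2

lemma map_eq_zero_of_map_eq_zero (hs : Function.Surjective (algebraMap S k)) (z : Ω[A⁄S])
    (hz : KaehlerDifferential.map S k A A₀ z = 0) : KaehlerDifferential.map S S A A₀ z = 0 := by
  have e : KaehlerDifferential.map S k A A₀ =
      (KaehlerDifferential.map S k A₀ A₀).restrictScalars A ∘ₗ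
        KaehlerDifferential.map S S A A₀ := by
    apply Derivation.liftKaehlerDifferential_unique
    ext a
    simp
  rw [e, LinearMap.comp_apply] at hz
  obtain ⟨c, hc⟩ := (exact_mapBaseChange_map S k A₀ _).mp hz
  have := subsingleton_of_surjective S k hs
  rw [← hc, Subsingleton.elim c 0, map_zero]

lemma sharp_map_map (P : PoissonBracket S A) (P₀ : PoissonBracket k A₀)
    (h : ∀ a b, P₀.br (algebraMap A A₀ a) (algebraMap A A₀ b) = algebraMap A A₀ (P.br a b))
    (x y : Ω[A⁄S]) : P₀.sharp (KaehlerDifferential.map S k A A₀ x)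
      (KaehlerDifferential.map S k A A₀ y) = algebraMap A A₀ (P.sharp x y) := by
  have hm : ∀ x : Ω[A⁄S], x ∈ Submodule.span A (Set.range (D S A)) := fun x => by
    rw [span_range_derivation]; trivial
  have hsm : ∀ (a : A) (z : Ω[A₀⁄k]), a • z = algebraMap A A₀ a • z :=
    fun a z => (algebraMap_smul A₀ a z).symm
  induction hm x using Submodule.span_induction with
  | zero => simp
  | add x x' _ _ hx hx' => simp only [map_add, LinearMap.add_apply, hx, hx']
  | smul a x _ hx => simp only [map_smul, hsm, LinearMap.smul_apply, hx, smul_eq_mul, map_mul]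
  | mem x hx =>
    obtain ⟨a, rfl⟩ := hx
    induction hm y using Submodule.span_induction with
    | zero => simp
    | add x x' _ _ hx hx' => simp only [map_add, hx, hx']
    | smul a x _ hx => simp only [map_smul, hsm, hx, smul_eq_mul, map_mul]
    | mem x hx =>
      obtain ⟨b, rfl⟩ := hx
      simp [h]

/-- If the reduction of a Poisson bracket modulo a nilpotent ideal of the base is nondegenerate,
then so is the bracket itself; no flatness is required, since a frame can be lifted. -/
lemma nondegenerate_of_tower (P : PoissonBracket S A) (P₀ : PoissonBracket k A₀)
    (h : ∀ a b, P₀.br (algebraMap A A₀ a) (algebraMap A A₀ b) = algebraMap A A₀ (P.br a b))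
    (hP₀ : P₀.Nondegenerate) (hk : Function.Surjective (algebraMap S k))
    (hs : Function.Surjective (algebraMap A A₀)) (I : Ideal S) (hnil : IsNilpotent I)
    (hI : ∀ s ∈ I, algebraMap S A₀ s = 0)
    (hker : RingHom.ker (algebraMap A A₀) ≤ I.map (algebraMap S A)) : P.Nondegenerate := by
  obtain ⟨m, x₀, y₀, hf⟩ := hP₀
  have hsurj := map_surjective_of_surjective S k A A₀ hs
  choose x hx using fun i => hsurj (x₀ i)
  choose y hy using fun i => hsurj (y₀ i)
  have hJ : IsNilpotent (I.map (algebraMap S A)) := by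
    obtain ⟨n, hn⟩ := hnil
    exact ⟨n, by rw [← Ideal.map_pow, hn, Ideal.zero_eq_bot, Ideal.map_bot, Ideal.zero_eq_bot]⟩
  obtain ⟨x', hx'⟩ := exists_isFrame_of_nilpotent (B := P.sharp) (x := x) (y := y) hJ fun z => by
    apply mem_smul_top_of_map_eq_zero S hs I hI hker
    apply map_eq_zero_of_map_eq_zero (k := k) hk
    rw [map_sub, map_sum, sub_eq_zero]
    conv_rhs => rw [← hf (KaehlerDifferential.map S k A A₀ z)]
    refine Finset.sum_congr rfl fun i _ => ?_
    rw [map_smul, ← algebraMap_smul A₀, ← sharp_map_map P P₀ h, hx, hy]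
  exact ⟨m, x', y, hx'⟩

end Tower

lemma nondegenerate_of_reduction (ρ : S →+* k) (φ : A →+* A₀)
    (hφ : φ.comp (algebraMap S A) = (algebraMap k A₀).comp ρ) (P : PoissonBracket S A)
    (P₀ : PoissonBracket k A₀) (h : ∀ a b, P₀.br (φ a) (φ b) = φ (P.br a b))
    (hP₀ : P₀.Nondegenerate) (hρ : Function.Surjective ρ) (hs : Function.Surjective φ)
    (hnil : IsNilpotent (RingHom.ker ρ))
    (hker : RingHom.ker φ ≤ (RingHom.ker ρ).map (algebraMap S A)) : P.Nondegenerate := by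
  let : Algebra S k := ρ.toAlgebra
  let : Algebra A A₀ := φ.toAlgebra
  let : Algebra S A₀ := (φ.comp (algebraMap S A)).toAlgebra
  have : IsScalarTower S A A₀ := IsScalarTower.of_algebraMap_eq' rfl
  have : IsScalarTower S k A₀ := IsScalarTower.of_algebraMap_eq' hφ
  refine nondegenerate_of_tower P P₀ h hP₀ hρ hs _ hnil (fun s hs => ?_) hker
  have h0 : algebraMap S k s = 0 := hs
  rw [IsScalarTower.algebraMap_apply S k A₀, h0, map_zero]

end Lifting

end PoissonDeRham

namespace PoissonDeRham

open KaehlerDifferential TensorProduct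

/-! ### The affine pieces of a symplectic manifold -/

section StandardSmooth

variable {k A : Type} [CommRing k] [CommRing A] [Algebra k A]

/-- The differentials of an algebra which is standard smooth of relative dimension `n` are
generated by `n` elements. -/
lemma exists_span_kaehler_eq_top (n : ℕ) [Algebra.IsStandardSmoothOfRelativeDimension n k A] :
    ∃ e : Fin n → Ω[A⁄k], Submodule.span A (Set.range e) = ⊤ := by
  have : Algebra.IsStandardSmooth k A :=
    Algebra.IsStandardSmoothOfRelativeDimension.isStandardSmooth n
  cases subsingleton_or_nontrivial A with
  | inl h =>
    have : Subsingleton Ω[A⁄k] := Module.subsingleton A _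
    exact ⟨fun _ => 0, Subsingleton.elim _ _⟩
  | inr h =>
    have hr := Algebra.IsStandardSmoothOfRelativeDimension.rank_kaehlerDifferential (R := k)
      (S := A) n
    have hf : Module.finrank A Ω[A⁄k] = n := Module.finrank_eq_of_rank_eq hr
    exact ⟨Module.finBasisOfFinrankEq A _ hf, (Module.finBasisOfFinrankEq A _ hf).span_eq⟩

/-- If a localization of `Ω` at `t` is generated by `n` elements, then so is `Ω` up to powers
of `t`. -/
lemma exists_pow_smul_mem_span {n : ℕ} (t : A) (B : Type) [CommRing B] [Algebra A B] [Algebra k B]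
    [IsScalarTower k A B] [IsLocalization.Away t B] (e : Fin n → Ω[B⁄k])
    (he : Submodule.span B (Set.range e) = ⊤) :
    ∃ e' : Fin n → Ω[A⁄k], ∀ z, ∃ l : ℕ, t ^ l • z ∈ Submodule.span A (Set.range e') := by
  have hloc : IsLocalizedModule (Submonoid.powers t) (KaehlerDifferential.map k k A B) :=
    KaehlerDifferential.isLocalizedModule_map k A B (Submonoid.powers t)
  choose w hw using fun i => IsLocalizedModule.surj (Submonoid.powers t)
    (KaehlerDifferential.map k k A B) (e i)
  refine ⟨fun i => (w i).1, fun z => ?_⟩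
  have hz : KaehlerDifferential.map k k A B z ∈ Submodule.span B (Set.range e) := by
    rw [he]; trivial
  have hsm : ∀ (a : A) (z : Ω[B⁄k]), a • z = algebraMap A B a • z :=
    fun a z => (algebraMap_smul B a z).symm
  have key : ∀ u ∈ Submodule.span B (Set.range e), ∃ (l : ℕ),
      ∃ v ∈ Submodule.span A (Set.range fun i => (w i).1),
        t ^ l • u = KaehlerDifferential.map k k A B v := by
    intro u hu
    induction hu using Submodule.span_induction with
    | mem x hx =>
      obtain ⟨i, rfl⟩ := hx
      obtain ⟨l, hl⟩ := (w i).2.2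
      refine ⟨l, _, Submodule.subset_span ⟨i, rfl⟩, ?_⟩
      change t ^ l = _ at hl
      rw [hl]
      exact hw i
    | zero => exact ⟨0, 0, zero_mem _, by simp⟩
    | add x y _ _ hx hy =>
      obtain ⟨l, v, hv, h⟩ := hx
      obtain ⟨l', v', hv', h'⟩ := hy
      refine ⟨l + l', t ^ l' • v + t ^ l • v', add_mem (Submodule.smul_mem _ _ hv)
        (Submodule.smul_mem _ _ hv'), ?_⟩
      rw [map_add, map_smul, map_smul, ← h, ← h', smul_smul, smul_smul, smul_add, pow_add, mul_comm]
    | smul b x _ hx =>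
      obtain ⟨l, v, hv, h⟩ := hx
      obtain ⟨⟨a, ⟨_, l', rfl⟩⟩, hb⟩ := IsLocalization.surj (Submonoid.powers t) b
      refine ⟨l' + l, a • v, Submodule.smul_mem _ _ hv, ?_⟩
      rw [map_smul, ← h, pow_add, mul_smul, smul_comm (t ^ l) b, hsm (t ^ l') (b • _), smul_smul,
        mul_comm]
      rw [show b * (algebraMap A B) (t ^ l') = algebraMap A B a from hb, ← hsm]
  obtain ⟨l, v, hv, h⟩ := key _ hz
  rw [← map_smul] at h
  obtain ⟨⟨_, l', rfl⟩, hc⟩ := IsLocalizedModule.exists_of_eq (S := Submonoid.powers t) h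
  refine ⟨l' + l, ?_⟩
  rw [pow_add, mul_smul]
  have hc' : t ^ l' • t ^ l • z = t ^ l' • v := hc
  rw [hc']
  exact Submodule.smul_mem _ _ hv

/-- There are no forms of degree `> n` on an algebra locally standard smooth of relative
dimension `n`. -/
lemma subsingleton_form_of_locally (n : ℕ)
    (h : RingHom.Locally (RingHom.IsStandardSmoothOfRelativeDimension n) (algebraMap k A)) :
    Subsingleton (Form k A (n + 1)) := by
  obtain ⟨s, hs, h⟩ := h
  refine subsingleton_exteriorPower_of_locally s hs fun t ht => ?_
  have h1 := h t ht
  rw [← IsScalarTower.algebraMap_eq k A (Localization.Away t),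
    RingHom.isStandardSmoothOfRelativeDimension_algebraMap] at h1
  obtain ⟨e, he⟩ := exists_span_kaehler_eq_top (k := k) (A := Localization.Away t) n
  exact exists_pow_smul_mem_span t (Localization.Away t) e he

end StandardSmooth

section Symplectic

variable {k A : Type} [CommRing k] [CommRing A] [Algebra k A]

lemma atPoint_eq_zero {n : ℕ} (η : Form k A n) (p : PrimeSpectrum A) (r : A) (hr : r ∉ p.asIdeal)
    (h : r • (η : FormAlg k A) ∈ p.asIdeal • (⊤ : Submodule A (FormAlg k A))) :
    η.atPoint p = 0 := by
  let pr : FormAlg k A →ₗ[A] Form k A n :=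
    DirectSum.component A ℕ (fun i => ⋀[A]^i Ω[A⁄k]) n ∘ₗ
      (DirectSum.decomposeLinearEquiv (fun i => ⋀[A]^i Ω[A⁄k])).toLinearMap
  have hpr : ∀ η : Form k A n, pr η = η := by
    intro η
    simp only [pr, LinearMap.comp_apply]
    apply Subtype.ext
    exact DirectSum.decompose_of_mem_same (fun i => ⋀[A]^i Ω[A⁄k]) η.2
  have h1 : pr (r • (η : FormAlg k A)) ∈ (p.asIdeal • (⊤ : Submodule A (FormAlg k A))).map pr :=
    ⟨_, h, rfl⟩
  rw [Submodule.map_smul'', map_smul, hpr] at h1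
  have h2 : ∀ ξ ∈ p.asIdeal • (⊤ : Submodule A (Form k A n)),
      (1 : p.asIdeal.ResidueField) ⊗ₜ[A] ξ = 0 := by
    intro ξ hξ
    induction hξ using Submodule.smul_induction_on' with
    | smul a ha x _ =>
      rw [← smul_tmul, Algebra.smul_def, Ideal.algebraMap_residueField_eq_zero.mpr ha, zero_mul,
        zero_tmul]
    | add x _ y _ hx hy => rw [tmul_add, hx, hy, add_zero]
  have h3 := h2 _ (Submodule.smul_mono le_rfl le_top h1)
  rw [← smul_tmul, Algebra.smul_def, mul_one] at h3
  have hr' : algebraMap A p.asIdeal.ResidueField r ≠ 0 := fun h0 =>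
    hr (Ideal.algebraMap_residueField_eq_zero.mp h0)
  have h4 := congrArg (fun z => (algebraMap A p.asIdeal.ResidueField r)⁻¹ • z) h3
  simp only [smul_zero, smul_tmul', smul_eq_mul, inv_mul_cancel₀ hr'] at h4
  exact h4

/-- The Poisson bracket of a symplectic form is nondegenerate. -/
lemma nondegenerate_of_symplectic [Module.Finite A Ω[A⁄k]] [Module.Projective A Ω[A⁄k]] (d : ℕ)
    [Subsingleton (Form k A (d * 2 + 1))] (ω : Form k A 2)
    (hω : ∀ p : PrimeSpectrum A, (ω.twoPow d).atPoint p ≠ 0) (P : PoissonBracket k A)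
    (hP : ∀ (a b : A) (ha hb : Derivation k A A), IsHamiltonian ω a ha → IsHamiltonian ω b hb →
      P.br a b = ω.eval ![ha, hb]) : P.Nondegenerate := by
  have hsurj : Function.Surjective (flat (ω : FormAlg k A)) := by
    refine flat_surjective ω.2 d (fun x => ?_) fun p hp r hr h =>
      hω ⟨p, hp.isPrime⟩ (atPoint_eq_zero (ω.twoPow d) ⟨p, hp.isPrime⟩ r hr h)
    have h1 : ExteriorAlgebra.ι A x * (ω : FormAlg k A) ^ d ∈ ⋀[A]^(d * 2 + 1) Ω[A⁄k] := by
      rw [add_comm (d * 2) 1]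
      refine SetLike.mul_mem_graded (A := fun n => ⋀[A]^n Ω[A⁄k]) ?_ (ω.twoPow d).2
      change _ ∈ LinearMap.range (ExteriorAlgebra.ι A) ^ 1
      rw [pow_one]
      exact ⟨x, rfl⟩
    exact congrArg Subtype.val (Subsingleton.elim (⟨_, h1⟩ : Form k A (d * 2 + 1)) 0)
  have hinj : ∀ f, flat (ω : FormAlg k A) f = 0 → f = 0 := by
    intro f hf
    refine LinearMap.ext fun z => ?_
    obtain ⟨g, rfl⟩ := hsurj z
    rw [flat_swap ω.2, hf, map_zero, neg_zero, LinearMap.zero_apply]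
  have hham : ∀ a : A, ∃ v : Derivation k A A, IsHamiltonian ω a v ∧
      flat (ω : FormAlg k A) v.liftKaehlerDifferential = -D k A a := by
    intro a
    obtain ⟨f, hf⟩ := hsurj (-D k A a)
    have e : (f.compDer (D k A)).liftKaehlerDifferential = f :=
      Derivation.liftKaehlerDifferential_unique _ _ (Derivation.liftKaehlerDifferential_comp _)
    refine ⟨f.compDer (D k A), fun v => ?_, by rw [e, hf]⟩
    rw [eval_two, flat_swap ω.2, e, hf, map_neg, neg_neg,
      Derivation.liftKaehlerDifferential_comp_D]
  choose v hv hv' using hham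
  have hflat : ∀ z, flat (ω : FormAlg k A) (P.sharp z) = -z := by
    have : flat (ω : FormAlg k A) ∘ₗ P.sharp = -LinearMap.id := by
      apply Derivation.liftKaehlerDifferential_unique
      ext1 a
      change flat (ω : FormAlg k A) (P.sharp (D k A a)) = -D k A a
      rw [← hv' a, P.sharp_D]
      congr 2
      ext b
      rw [P.ham_apply, hP a b _ _ (hv a) (hv b), hv b]
    exact fun z => congrArg (fun F => F z) this
  refine exists_isFrame_of_surjective fun f => ⟨-flat (ω : FormAlg k A) f, ?_⟩
  rw [← sub_eq_zero]
  apply hinj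
  rw [map_sub, hflat, neg_neg, sub_self]

end Symplectic

end PoissonDeRham

namespace PoissonDeRham

open KaehlerDifferential CategoryTheory AlgebraicGeometry

/-! ### Affine open subsets of a Poisson deformation -/

/-- Base change along a surjective ring homomorphism is surjective, and its kernel is generated by
the kernel of that homomorphism. -/
lemma surjective_and_ker_le_of_isPushout {R A R' A' : CommRingCat.{0}} {f : R ⟶ A} {g : R ⟶ R'}
    {f' : A ⟶ A'} {g' : R' ⟶ A'} (h : IsPushout f g f' g') (hg : Function.Surjective g.hom) :
    Function.Surjective f'.hom ∧ RingHom.ker f'.hom ≤ (RingHom.ker g.hom).map f.hom := by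
  let J := (RingHom.ker g.hom).map f.hom
  have hJ : RingHom.ker g.hom ≤ RingHom.ker ((Ideal.Quotient.mk J).comp f.hom) := by
    intro r hr
    rw [RingHom.mem_ker, RingHom.comp_apply, Ideal.Quotient.eq_zero_iff_mem]
    exact Ideal.mem_map_of_mem _ hr
  let l : R' →+* A ⧸ J := RingHom.liftOfSurjective g.hom hg ⟨_, hJ⟩
  have hl : l.comp g.hom = (Ideal.Quotient.mk J).comp f.hom :=
    RingHom.liftOfRightInverse_comp _ _ _ _
  let u : A' ⟶ CommRingCat.of (A ⧸ J) := h.desc (CommRingCat.ofHom (Ideal.Quotient.mk J))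
    (CommRingCat.ofHom l) (by ext r; exact (congrArg (fun F => F r) hl).symm)
  have hu : f' ≫ u = CommRingCat.ofHom (Ideal.Quotient.mk J) := h.inl_desc _ _ _
  have hu' : g' ≫ u = CommRingCat.ofHom l := h.inr_desc _ _ _
  have hw : ∀ r, f'.hom (f.hom r) = g'.hom (g.hom r) := fun r => congrArg (fun F => F.hom r) h.w
  have hker : J ≤ RingHom.ker f'.hom := by
    rw [Ideal.map_le_iff_le_comap]
    intro r hr
    rw [Ideal.mem_comap, RingHom.mem_ker, hw, RingHom.mem_ker.mp hr, map_zero]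
  let v : A ⧸ J →+* A' := Ideal.Quotient.lift J f'.hom hker
  have hv : ∀ a, v (Ideal.Quotient.mk J a) = f'.hom a := fun a => Ideal.Quotient.lift_mk _ _ _
  have huv : u ≫ CommRingCat.ofHom v = 𝟙 A' := by
    apply h.hom_ext
    · rw [← Category.assoc, hu, Category.comp_id]
      ext a
      exact hv a
    · rw [← Category.assoc, hu', Category.comp_id]
      ext r'
      obtain ⟨r, rfl⟩ := hg r'
      have : l (g.hom r) = Ideal.Quotient.mk J (f.hom r) := congrArg (fun F => F r) hl
      exact (congrArg v this).trans ((hv _).trans (hw r))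
  constructor
  · intro z
    obtain ⟨a, ha⟩ := Ideal.Quotient.mk_surjective (u.hom z)
    refine ⟨a, ?_⟩
    have h1 : v (u.hom z) = z := congrArg (fun F => F.hom z) huv
    rw [← h1, ← ha, hv]
  · intro a ha
    have h1 : u.hom (f'.hom a) = Ideal.Quotient.mk J a := congrArg (fun F => F.hom a) hu
    rw [RingHom.mem_ker.mp ha, map_zero] at h1
    exact Ideal.Quotient.eq_zero_iff_mem.mp h1.symm

section Schemes

variable {S : Type} [CommRing S] {X : Scheme.{0}} (π : X ⟶ Spec (CommRingCat.of S))

/-- Restriction between affine open subsets is formally unramified, so that the differentials of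
restricted functions generate. -/
lemma span_D_res {V W : X.Opens} (hV : IsAffineOpen V) (hW : IsAffineOpen W) (h : W ≤ V) :
    Submodule.span (Sec π W) (Set.range fun a => D S (Sec π W) (Sec.res π h a)) = ⊤ := by
  let : Algebra (Sec π V) (Sec π W) := (Sec.res π h).toRingHom.toAlgebra
  have : IsScalarTower S (Sec π V) (Sec π W) :=
    IsScalarTower.of_algebraMap_eq' (Sec.res π h).comp_algebraMap.symm
  have h1 : ((𝟙 X : X ⟶ X).appLE V W h).hom.FormallyUnramified :=
    HasRingHomProperty.appLE (P := @AlgebraicGeometry.FormallyUnramified) (𝟙 X) inferInstance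
      ⟨V, hV⟩ ⟨W, hW⟩ h
  have h2 : (𝟙 X : X ⟶ X).appLE V W h = X.presheaf.map (homOfLE h).op := by
    simp only [Scheme.Hom.appLE, Scheme.Hom.id_app]
    exact Category.id_comp _
  rw [h2] at h1
  have h3 : Algebra.FormallyUnramified (Sec π V) (Sec π W) := h1
  have h4 : Function.Surjective (mapBaseChange S (Sec π V) (Sec π W)) := fun z =>
    (exact_mapBaseChange_map S (Sec π V) (Sec π W) z).mp (Subsingleton.elim _ _)
  rw [eq_top_iff]
  intro z _
  obtain ⟨t, rfl⟩ := h4 z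
  have hm : ∀ x : Ω[Sec π V⁄S], KaehlerDifferential.map S S (Sec π V) (Sec π W) x ∈
      Submodule.span (Sec π W) (Set.range fun a => D S (Sec π W) (Sec.res π h a)) := by
    intro x
    have hx : x ∈ Submodule.span (Sec π V) (Set.range (D S (Sec π V))) := by
      rw [span_range_derivation]; trivial
    induction hx using Submodule.span_induction with
    | mem x hx =>
      obtain ⟨a, rfl⟩ := hx
      rw [KaehlerDifferential.map_D]
      exact Submodule.subset_span ⟨a, rfl⟩
    | zero => rw [map_zero]; exact zero_mem _
    | add x y _ _ hx hy => rw [map_add]; exact add_mem hx hy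
    | smul a x _ hx =>
      rw [map_smul, ← algebraMap_smul (Sec π W)]
      exact Submodule.smul_mem _ _ hx
  induction t using TensorProduct.induction_on with
  | zero => rw [map_zero]; exact zero_mem _
  | tmul b x => rw [mapBaseChange_tmul]; exact Submodule.smul_mem _ _ (hm x)
  | add x y hx hy => rw [map_add]; exact add_mem (hx trivial) (hy trivial)

end Schemes

section Smooth

variable {k : Type} [CommRing k] {X₀ : Scheme.{0}} (π₀ : X₀ ⟶ Spec (CommRingCat.of k))

lemma Sec.smooth [AlgebraicGeometry.Smooth π₀] {U : X₀.Opens} (hU : IsAffineOpen U) :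
    Algebra.Smooth k (Sec π₀ U) := by
  have h1 : (π₀.appLE ⊤ U le_top).hom.Smooth :=
    π₀.smooth_appLE (isAffineOpen_top _) hU le_top
  have h2 := RingHom.Smooth.respectsIso.2 _
    (Scheme.ΓSpecIso (CommRingCat.of k)).symm.commRingCatIsoToRingEquiv h1
  exact (RingHom.smooth_algebraMap (R := k) (S := Sec π₀ U)).mp h2

lemma Sec.locally_isStandardSmooth {n : ℕ} [SmoothOfRelativeDimension n π₀] {U : X₀.Opens}
    (hU : IsAffineOpen U) : RingHom.Locally (RingHom.IsStandardSmoothOfRelativeDimension n)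
      (algebraMap k (Sec π₀ U)) := by
  have h1 := HasRingHomProperty.appLE (P := @SmoothOfRelativeDimension n) π₀ inferInstance
    ⟨⊤, isAffineOpen_top _⟩ ⟨U, hU⟩ le_top
  exact (HasRingHomProperty.isLocal_ringHomProperty (@SmoothOfRelativeDimension n)).respectsIso.2 _
    (Scheme.ΓSpecIso (CommRingCat.of k)).symm.commRingCatIsoToRingEquiv h1

end Smooth

section Deformation

variable {S : Type} [CommRing S] [Algebra ℂ S] {ρ : S →ₐ[ℂ] ℂ} {X₀ X : Scheme.{0}}
  {π₀ : X₀ ⟶ Spec (CommRingCat.of ℂ)} {π : X ⟶ Spec (CommRingCat.of S)} {i : X₀ ⟶ X}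

/-- The bracket on an affine open subset of a symplectic manifold is nondegenerate. -/
lemma IsSymplecticManifold.nondegenerate {d : ℕ} {ω₀ : formSections π₀ 2 ⊤}
    (hX₀ : IsSymplecticManifold π₀ d ω₀) {P₀ : PoissonStructure π₀} (hP₀ : P₀.IsInducedBy ω₀)
    {U : X₀.Opens} (hU : IsAffineOpen U) : (P₀.bracket U).Nondegenerate := by
  have := hX₀.smooth
  have : AlgebraicGeometry.Smooth π₀ := SmoothOfRelativeDimension.smooth (d * 2) π₀
  have := Sec.smooth π₀ hU
  have := subsingleton_form_of_locally (d * 2) (Sec.locally_isStandardSmooth π₀ (n := d * 2) hU)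
  exact nondegenerate_of_symplectic d (formOn ω₀ ⟨U, hU, le_top⟩)
    (hX₀.nowhere_vanishing ⟨U, hU, le_top⟩) _ (hP₀ ⟨U, hU, le_top⟩)

/-- The closed fibre over an affine open subset, in terms of rings of functions. -/
lemma isPushout_Sec (h : IsPullback i π₀ π (Spec.map (CommRingCat.ofHom ρ.toRingHom)))
    {V : X.Opens} (hV : IsAffineOpen V) :
    IsPushout (CommRingCat.ofHom (algebraMap S (Sec π V))) (CommRingCat.ofHom ρ.toRingHom)
      (i.app V) (CommRingCat.ofHom (algebraMap ℂ (Sec π₀ (i ⁻¹ᵁ V)))) := by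
  have h1 := (isIso_pushoutSection_iff h (US := ⊤) (UT := ⊤) (UX := V) (UY := i ⁻¹ᵁ V)
    le_top le_top (by simp)).mp (isIso_pushoutSection_of_isAffineOpen h (US := ⊤) (UT := ⊤)
      (UX := V) (UY := i ⁻¹ᵁ V) le_top le_top (by simp) (isAffineOpen_top _) (isAffineOpen_top _)
        hV)
  refine h1.of_iso (Scheme.ΓSpecIso _) (Iso.refl _) (Scheme.ΓSpecIso _) (Iso.refl _) ?_ ?_ ?_ ?_
  · change _ = _ ≫ (Scheme.ΓSpecIso (CommRingCat.of S)).inv ≫ π.appLE ⊤ V le_top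
    rw [Iso.hom_inv_id_assoc]
    exact Category.comp_id _
  · have := Scheme.ΓSpecIso_naturality (CommRingCat.ofHom ρ.toRingHom)
    rw [← this]
    congr 1
  · refine (Category.comp_id _).trans (Eq.trans ?_ (Category.id_comp _).symm)
    simp [Scheme.Hom.appLE]
  · change _ = _ ≫ (Scheme.ΓSpecIso (CommRingCat.of ℂ)).inv ≫ π₀.appLE ⊤ (i ⁻¹ᵁ V) le_top
    rw [Iso.hom_inv_id_assoc]
    exact Category.comp_id _

/-- The bracket on an affine open subset of a Poisson deformation of a symplectic manifold is
nondegenerate. -/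
lemma IsPoissonDeformation.nondegenerate [IsLocalRing S] [IsArtinianRing S] {d : ℕ}
    {ω₀ : formSections π₀ 2 ⊤} (hX₀ : IsSymplecticManifold π₀ d ω₀) {P₀ : PoissonStructure π₀}
    (hP₀ : P₀.IsInducedBy ω₀) {P : PoissonStructure π} (hX : IsPoissonDeformation ρ P₀ P i)
    {V : X.Opens} (hV : IsAffineOpen V) : (P.bracket V).Nondegenerate := by
  have hρ : Function.Surjective ρ.toRingHom := fun c => ⟨algebraMap ℂ S c, by simp⟩
  have hi : IsAffineHom i :=
    MorphismProperty.of_isPullback hX.isPullback.flip inferInstance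
  have hpush := isPushout_Sec hX.isPullback hV
  obtain ⟨h1, h2⟩ := surjective_and_ker_le_of_isPushout hpush hρ
  refine nondegenerate_of_reduction ρ.toRingHom (Sec.pull π₀ π i V) ?_ (P.bracket V)
    (P₀.bracket (i ⁻¹ᵁ V)) (hX.bracket V) (hX₀.nondegenerate hP₀ (hV.preimage i)) hρ h1 ?_ h2
  · exact congrArg CommRingCat.Hom.hom hpush.w
  · obtain ⟨n, hn⟩ := IsArtinianRing.isNilpotent_jacobson_bot (R := S)
    refine ⟨n, eq_bot_iff.mpr (le_trans (Ideal.pow_right_mono ?_ n) hn.le)⟩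
    rw [IsLocalRing.jacobson_eq_maximalIdeal _ bot_ne_top]
    exact IsLocalRing.le_maximalIdeal (RingHom.ker_ne_top _)

end Deformation

end PoissonDeRham

namespace PoissonDeRham

open KaehlerDifferential CategoryTheory AlgebraicGeometry TopologicalSpace Opposite

/-! ### Globalization -/

open Limits ZeroObject in
/-- Isomorphisms in degrees `≥ 1` which commute with the differentials form an isomorphism of the
truncated complexes. -/
noncomputable def complexGeOneIso {C : Type*} [Category C] [HasZeroMorphisms C] [HasZeroObject C]
    {M M' : ℕ → C} {d : ∀ n, M n ⟶ M (n + 1)} {d' : ∀ n, M' n ⟶ M' (n + 1)}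
    (h : ∀ n, d n ≫ d (n + 1) = 0) (h' : ∀ n, d' n ≫ d' (n + 1) = 0) (e : ∀ n, M n ≅ M' n)
    (comm : ∀ n, (e n).hom ≫ d' n = d n ≫ (e (n + 1)).hom) :
    complexGeOne M d h ≅ complexGeOne M' d' h' :=
  HomologicalComplex.Hom.isoOfComponents
    (fun | 0 => Iso.refl _ | n + 1 => e (n + 1))
    (by
      rintro i j rfl
      simp only [complexGeOne, CochainComplex.of_d]
      cases i with
      | zero => exact (isZero_zero C).eq_of_src _ _
      | succ n => exact comm (n + 1))

namespace PoissonStructure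

variable {S : Type} [CommRing S] {X : Scheme.{0}} {π : X ⟶ Spec (CommRingCat.of S)}
  (P : PoissonStructure π) (hP : ∀ V : X.Opens, IsAffineOpen V → (P.bracket V).Nondegenerate)
  (hS : ∀ n : ℕ, IsUnit (n.factorial : S))

include hS in
lemma isUnit_factorial (V : X.Opens) (n : ℕ) : IsUnit (n.factorial : Sec π V) := by
  simpa using (hS n).map (algebraMap S (Sec π V))

/-- The isomorphism of sections over `U` from polyvector fields to forms. -/
noncomputable def sectionsEquiv (n : ℕ) (U : X.Opens) :
    polyvectorSections π n U ≃ₗ[S] formSections π n U where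
  toFun f := ⟨fun V => ((hP V.1 V.2.1).equiv (isUnit_factorial hS V.1) n).symm (f.1 V),
    fun V W h => formMap_eq_of_compatible (span_D_res π V.2.1 W.2.1 h) (P.res h)
      ((hP W.1 W.2.1).bijective_toPolyvector (isUnit_factorial hS W.1) n).injective (by
        rw [PoissonBracket.Nondegenerate.toPolyvector_equiv_symm,
          PoissonBracket.Nondegenerate.toPolyvector_equiv_symm]
        exact f.2 V W h)⟩
  map_add' f g := Subtype.ext (funext fun V => map_add _ _ _)
  map_smul' s f := Subtype.ext (funext fun V =>
    LinearMap.map_smul_of_tower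
      ((hP V.1 V.2.1).equiv (isUnit_factorial hS V.1) n).symm.toLinearMap s (f.1 V))
  invFun η := ⟨fun V => (P.bracket V.1).toPolyvector n (η.1 V), fun V W h => by
    beta_reduce
    rw [← η.2 V W h]
    exact compatible_toPolyvector _ _ _ (P.res h) _⟩
  left_inv f := Subtype.ext (funext fun V =>
    ((hP V.1 V.2.1).equiv (isUnit_factorial hS V.1) n).apply_symm_apply (f.1 V))
  right_inv η := Subtype.ext (funext fun V =>
    ((hP V.1 V.2.1).equiv (isUnit_factorial hS V.1) n).symm_apply_apply (η.1 V))

/-- The isomorphism of sheaves from polyvector fields to forms. -/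
noncomputable def sheafIso (n : ℕ) : polyvectorSheaf π n ≅ formSheaf π n :=
  NatIso.ofComponents (fun U => (P.sectionsEquiv hP hS n U.unop).toModuleIso)
    (fun _ => rfl)

lemma sheafIso_comp_d (n : ℕ) : (P.sheafIso hP hS n).hom ≫ formSheafD π n =
    P.delta n ≫ (P.sheafIso hP hS (n + 1)).hom := by
  ext U f
  apply Subtype.ext
  funext V
  have hV := hP V.1 V.2.1
  have hA := isUnit_factorial (π := π) hS V.1
  apply (hV.bijective_toPolyvector hA (n + 1)).injective
  change (P.bracket V.1).toPolyvector (n + 1) (formD S _ n ((hV.equiv hA n).symm (f.1 V))) =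
    (P.bracket V.1).toPolyvector (n + 1) ((hV.equiv hA (n + 1)).symm
      ((P.bracket V.1).delta n (f.1 V)))
  rw [hV.toPolyvector_equiv_symm hA, ← PoissonBracket.delta_toPolyvector,
    hV.toPolyvector_equiv_symm hA]

/-- The isomorphism of the Lichnerowicz–Poisson complex with the truncated de Rham complex. -/
noncomputable def lichnerowiczIso : P.lichnerowicz ≅ deRhamGeOne π :=
  complexGeOneIso _ _ (P.sheafIso hP hS) (P.sheafIso_comp_d hP hS)

/-- The global Poisson bivector. -/
noncomputable def bivector : polyvectorSections π 2 ⊤ :=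
  ⟨fun V => (P.bracket V.1).bivector, fun V W h => by
    rw [Polyvector.compatible_iff]
    intro a
    rw [PoissonBracket.toAlt_bivector, PoissonBracket.toAlt_bivector, P.res]⟩

/-- The relative symplectic form of a nondegenerate Poisson structure. -/
noncomputable def symplecticForm : formSections π 2 ⊤ := P.sectionsEquiv hP hS 2 ⊤ P.bivector

lemma formOn_component (n : ℕ) (U : X.Opens) (f : polyvectorSections π (n + 1) U)
    (V : AffineIn U) : formOn (P.component (P.lichnerowiczIso hP hS).hom n U f) V =
      ((hP V.1 V.2.1).equiv (isUnit_factorial hS V.1) (n + 1)).symm (polyvectorOn f V) := rfl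

lemma formOn_symplecticForm (V : AffineIn (⊤ : X.Opens)) : formOn (P.symplecticForm hP hS) V =
    (hP V.1 V.2.1).form (isUnit_factorial hS V.1) := rfl

end PoissonStructure

end PoissonDeRham

open CategoryTheory AlgebraicGeometry KaehlerDifferential PoissonDeRham in
theorem proposition9
    {S : Type} [CommRing S] [Algebra ℂ S] [IsLocalRing S] [IsArtinianRing S] (ρ : S →ₐ[ℂ] ℂ)
    {X₀ : Scheme.{0}} (π₀ : X₀ ⟶ Spec (CommRingCat.of ℂ)) (d : ℕ) (ω₀ : formSections π₀ 2 ⊤)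
    (hX₀ : IsSymplecticManifold π₀ d ω₀)
    (P₀ : PoissonStructure π₀) (hP₀ : P₀.IsInducedBy ω₀)
    {X : Scheme.{0}} (π : X ⟶ Spec (CommRingCat.of S)) (P : PoissonStructure π) (i : X₀ ⟶ X)
    (hX : IsPoissonDeformation ρ P₀ P i) :
    ∃ ω : formSections π 2 ⊤,
      (∀ (V : AffineIn (⊤ : X.Opens)) (a b : Sec π V.1),
        (formOn ω V).eval ![(P.bracket V.1).ham a, (P.bracket V.1).ham b] = (P.bracket V.1).br a b) ∧
      formSections.d π 2 ⊤ ω = 0 ∧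
      ∃ Φ : P.lichnerowicz ≅ deRhamGeOne π,
        (∀ (n : ℕ) (U : X.Opens) (f : polyvectorSections π (n + 1) U) (V : AffineIn U)
          (v : Fin (n + 1) → Derivation S (Sec π V.1) (Sec π V.1)),
          polyvectorOn f V = Polyvector.wedge v →
            (formOn (P.component Φ.hom n U f) V : FormAlg S (Sec π V.1)) =
              (List.ofFn fun k => contract (v k) (formOn ω (V.incl le_top) : FormAlg S _)).prod) ∧
        (∀ (n : ℕ) (U : X.Opens) (f : polyvectorSections π (n + 1) U) (V : AffineIn U)
          (a : Fin (n + 1) → Sec π V.1),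
          (formOn (P.component Φ.hom n U f) V).eval (fun k => (P.bracket V.1).ham (a k)) =
            polyvectorOn f V (exteriorPower.ιMulti _ (n + 1) fun k => D S _ (a k))) ∧
        QuasiIso ((sheafifyComplex S X).map Φ.hom) := by
  have hP : ∀ V : X.Opens, IsAffineOpen V → (P.bracket V).Nondegenerate := fun V hV =>
    hX.nondegenerate hX₀ hP₀ hV
  have hS : ∀ n : ℕ, IsUnit (n.factorial : S) := fun n => by
    have h : IsUnit (n.factorial : ℂ) := (Nat.cast_ne_zero.mpr n.factorial_ne_zero).isUnit
    simpa using h.map (algebraMap ℂ S)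
  refine ⟨P.symplecticForm hP hS, fun V a b => ?_, ?_, P.lichnerowiczIso hP hS,
    fun n U f V v hv => ?_, fun n U f V a => ?_, inferInstance⟩
  · rw [P.formOn_symplecticForm]
    exact PoissonBracket.Nondegenerate.eval_form _ _ a b
  · apply Subtype.ext
    funext V
    exact PoissonBracket.Nondegenerate.formD_form (hP V.1 V.2.1)
      (PoissonStructure.isUnit_factorial hS V.1)
  · rw [P.formOn_component, hv, P.formOn_symplecticForm]
    exact PoissonBracket.Nondegenerate.equiv_symm_wedge _ _ v
  · rw [P.formOn_component, ← PoissonBracket.toAlt_toPolyvector,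
      PoissonBracket.Nondegenerate.toPolyvector_equiv_symm, Polyvector.toAlt_apply]
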